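/- Let $v_1,\dots,v_r\in\mathbb Z^n$ and $\mathbf a=(a_1,\dots,a_r)\in\mathbb Z^r$. Put $H_i=\{x\in\mathbb R^n:\langle v_i,x\rangle+a_i=0\}$ and $P=P_{\mathbf a}=\bigcap_i\{x\in\mathbb R^n:\langle v_i,x\rangle+a_i\ge 0\}$. Assume that $\sum_i v_i=0$, that $P$ is compact, and that $H_i\cap P\neq\emptyset$ for every $i$. For $k\ge 1$ let $k\mathbf a=(ka_1,\dots,ka_r)$, so $P_{k\mathbf a}=kP$, and let $K$ be the set of those $k\ge1$ for which $kP$ contains a lattice point. For $k\in K$ let $\mathbf X_{k\mathbf a}$ be the random vector with $$\mathbb P(\mathbf X_{k\mathbf a}=x)=\frac1{b_k}\binom{\sum_i(\langle v_i,x\rangle+ka_i)}{\langle v_1,x\rangle+ka_1,\dots,\langle v_r,x\rangle+ka_r}\qquad(x\in kP\cap\mathbb Z^n),$$ where $b_k$ is the normalizing constant, and let $\mathbf Y_k=(\mathbf X_{k\mathbf a}-\mathbb E[\mathbf X_{k\mathbf a}])/\sqrt k$. Let $L$ be the linear span of the differences of points of $P$, let $I_{\mathbf a}$ be the set of the indices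 $i$ for which $\langle v_i,\cdot\rangle$ is not constant on $P$, and let $\phi_{\mathbf a}(x)=\prod_i(\langle v_i,x\rangle+a_i)^{\langle v_i,x\rangle+a_i}$ on $P$, with $0^0=1$. Then $K$ is infinite, $\phi_{\mathbf a}$ has a unique minimizer $m_{\mathbf a}$ on $P$, this point lies in the relative interior of $P$, the quadratic form $q(x)=\sum_{i\in I_{\mathbf a}}\langle v_i,x\rangle^2/(\langle v_i,m_{\mathbf a}\rangle+a_i)$ is positive definite on $L$, and, as $k\to\infty$ in $K$, $\mathbf Y_k$ converges weakly to the centred Gaussian probability measure on $\mathbb R^n$ that is supported on $L$ and has density $$\frac{e^{-q(x)/2}}{\int_L e^{-q(y)/2}\,dy}$$ with respect to Lebesgue measure $dx$ on $L$ (the unit mass at $0$ if $L=0$). -/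

import Mathlib

open MeasureTheory Filter Topology
open scoped ENNReal

noncomputable section

namespace PolyMult

/-- The ambient Euclidean space `ℝⁿ`. -/
abbrev E (n : ℕ) := EuclideanSpace ℝ (Fin n)

variable {n r : ℕ}

/-- The standard pairing `⟨w, x⟩` of an integer vector `w` with a real vector `x`. -/
def pairing (w : Fin n → ℤ) (x : E n) : ℝ := ∑ j, (w j : ℝ) * x j

/-- The hyperplane `H_i = {x | ⟨v_i, x⟩ + a_i = 0}`. -/
def hyperplane (v : Fin r → Fin n → ℤ) (a : Fin r → ℤ) (i : Fin r) : Set (E n) :=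
  {x | pairing (v i) x + a i = 0}

/-- The polyhedron `P = ⋂ i, {x | ⟨v_i, x⟩ + a_i ≥ 0}`. -/
def polyhedron (v : Fin r → Fin n → ℤ) (a : Fin r → ℤ) : Set (E n) :=
  ⋂ i, {x | 0 ≤ pairing (v i) x + a i}

/-- An integer vector, seen in `ℝⁿ`. -/
def toReal (x : Fin n → ℤ) : E n := WithLp.toLp 2 fun j => (x j : ℝ)

/-- The lattice points `P ∩ ℤⁿ`. -/
def latticePoints (v : Fin r → Fin n → ℤ) (a : Fin r → ℤ) : Set (Fin n → ℤ) :=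
  {x | toReal x ∈ polyhedron v a}

/-- The multinomial coefficient with top entry `∑ i, (⟨v_i, x⟩ + a_i)` and bottom entries
`⟨v_i, x⟩ + a_i`; these integers are nonnegative when `x` is a lattice point of `P`. -/
def weight (v : Fin r → Fin n → ℤ) (a : Fin r → ℤ) (x : Fin n → ℤ) : ℕ :=
  Nat.multinomial Finset.univ fun i => (v i ⬝ᵥ x + a i).toNat

/-- The normalizing constant `b`. -/
def totalWeight (v : Fin r → Fin n → ℤ) (a : Fin r → ℤ) : ℝ≥0∞ :=
  ∑' x : latticePoints v a, (weight v a x : ℝ≥0∞)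

/-- The polyhedral multinomial distribution, that is, the law of `X_a`. It is a probability measure
when `P` is compact and contains a lattice point. -/
def law (v : Fin r → Fin n → ℤ) (a : Fin r → ℤ) : Measure (E n) :=
  (totalWeight v a)⁻¹ •
    Measure.sum fun x : latticePoints v a => (weight v a x : ℝ≥0∞) • Measure.dirac (toReal x.1)

/-- The law of `Y_k = (X_{k a} - 𝔼[X_{k a}]) / √k`. -/
def rescaledLaw (v : Fin r → Fin n → ℤ) (a : Fin r → ℤ) (k : ℕ) : Measure (E n) :=
  (law v (k • a)).map fun x => (Real.sqrt k)⁻¹ • (x - ∫ y, y ∂(law v (k • a)))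

/-- The positive integers `k` for which `X_{k a}` is defined, that is, for which the polyhedron of
`k a` contains a lattice point. -/
def admissible (v : Fin r → Fin n → ℤ) (a : Fin r → ℤ) : Set ℕ :=
  {k | 0 < k ∧ (latticePoints v (k • a)).Nonempty}

/-- The potential `φ_a(x) = ∏ i, (⟨v_i, x⟩ + a_i) ^ (⟨v_i, x⟩ + a_i)`, with `0 ^ 0 = 1`. -/
def potential (v : Fin r → Fin n → ℤ) (a : Fin r → ℤ) (x : E n) : ℝ :=
  ∏ i, (pairing (v i) x + a i) ^ (pairing (v i) x + a i)

open Classical in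
/-- The set `I_a` of the indices `i` such that `⟨v_i, ·⟩` is not constant on `P`. -/
def nonconstIndices (v : Fin r → Fin n → ℤ) (a : Fin r → ℤ) : Finset (Fin r) :=
  {i | ∃ x ∈ polyhedron v a, ∃ y ∈ polyhedron v a, pairing (v i) x ≠ pairing (v i) y}

/-- The subspace `L` spanned by the differences of points of `P`. -/
def directionSpace (v : Fin r → Fin n → ℤ) (a : Fin r → ℤ) : Submodule ℝ (E n) :=
  vectorSpan ℝ (polyhedron v a)

/-- The quadratic form `x ↦ ∑ i ∈ I_a, ⟨v_i, x⟩² / (⟨v_i, m⟩ + a_i)`. -/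
def quadForm (v : Fin r → Fin n → ℤ) (a : Fin r → ℤ) (m x : E n) : ℝ :=
  ∑ i ∈ nonconstIndices v a, pairing (v i) x ^ 2 / (pairing (v i) m + a i)

/-- Lebesgue measure on a subspace `L` of `ℝⁿ`, for the Euclidean structure induced on `L`
(the unit point mass if `L = 0`). The default `volume` on the subtype `L` is not used because it
may stand for the restriction of the `n`-dimensional Lebesgue measure. -/
def subspaceLebesgue (L : Submodule ℝ (E n)) : Measure L :=
  (stdOrthonormalBasis ℝ L).toBasis.addHaar

/-- The measure on `L` with density `exp (-q / 2)` with respect to Lebesgue measure on `L`, pushed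
forward to `ℝⁿ` and normalized by its total mass. -/
def gaussianOn (L : Submodule ℝ (E n)) (q : E n → ℝ) : Measure (E n) :=
  (∫⁻ x : L, ENNReal.ofReal (Real.exp (-(1 / 2) * q x)) ∂(subspaceLebesgue L))⁻¹ •
    ((subspaceLebesgue L).withDensity fun x : L =>
      ENNReal.ofReal (Real.exp (-(1 / 2) * q x))).map (fun x : L => (x : E n))

end PolyMult

end

open MeasureTheory Filter Topology
open scoped ENNReal

noncomputable section

namespace PolyMult

/-! On `k P` the multinomial law is a conditioned product of Poisson laws, and the minimizer `m` is
what makes the means right. Write `g_i = ⟨v_i, m⟩ + a_i` and, for a lattice point `x` of `k P`, `l_i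
= ⟨v_i, x⟩ + k a_i`. The weight of `x` is `N! / ∏ l_i!`, and `N = ∑ l_i` does not depend on `x`
because `∑ v_i = 0`. Vanishing of the derivative of `∑ u_i log u_i` at `m` says that `∑ ⟨v_i, w⟩ log
g_i = 0` for `w ∈ L`, so `∏ (k g_i) ^ l_i` does not depend on `x` either. Hence the weight is
proportional to the product over `I_a` of Poisson probabilities of `l_i` with mean `k g_i`
(`exists_weight_eq_mul_productWeight`). The means are positive since `u log u` has slope `-∞` at `0`
(`gap_pos_of_isMinOn`).

At `x = k m + √k y` each rescaled Poisson factor tends to `exp (-⟨v_i, y⟩² / (2 g_i))`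
(`tendsto_poissonWeight`), with a Gaussian bound valid over all of `k P`
(`exists_poissonWeight_le_exp`). The lattice points of `k P` lie in one coset of `L ∩ ℤⁿ`, a lattice
of full rank in `L` because `L` is cut out by integral equations (`exists_lattice_basis`). Sums over
this coset become integrals of functions constant on cells of side `1 / √k`, and dominated
convergence applies (`tendsto_integral_cellDensity`).

The domination allows test functions of linear growth. The identity is one of them and its Gaussian
integral is zero by oddness, so `(𝔼 X - k m) / √k → 0` and centring at the mean is asymptotically
centring at `k m` (`tendsto_rescaledLaw`). -/

/-! ### Poisson weights: Gaussian bound and local limit theorem. -/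

/-- The Poisson weight `e^{-μ} μ ^ l / l!`, rescaled by `√(2 π μ)`. -/
def poissonWeight (μ : ℝ) (l : ℕ) : ℝ :=
  √(2 * Real.pi * μ) * (Real.exp (-μ) * μ ^ l / l.factorial)

lemma poissonWeight_nonneg {μ : ℝ} (hμ : 0 ≤ μ) (l : ℕ) : 0 ≤ poissonWeight μ l := by
  unfold poissonWeight; positivity

/-- Stirling's lower bound, with `2 π l` weakened to `l + 1` so that `l = 0` is included. -/
lemma sqrt_succ_mul_pow_le_factorial (l : ℕ) :
    √(l + 1) * (l / Real.exp 1) ^ l ≤ l.factorial := by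
  rcases Nat.eq_zero_or_pos l with rfl | hl
  · simp
  · refine le_trans ?_ (Stirling.le_factorial_stirling l)
    gcongr
    have : (1 : ℝ) ≤ l := by exact_mod_cast hl
    nlinarith [Real.pi_gt_three]

/-- The inequality `log t ≤ t - 1` at `t = √μ / √l` gives `l log (μ / l) ≤ 2 √(l μ) - 2 l`, which
completes the square in `√l - √μ`. -/
lemma exp_neg_mul_pow_le {μ : ℝ} (hμ : 0 < μ) (l : ℕ) :
    Real.exp (-μ) * μ ^ l ≤ (l / Real.exp 1) ^ l * Real.exp (-(√l - √μ) ^ 2) := by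
  rcases Nat.eq_zero_or_pos l with rfl | hl
  · simp [Real.sq_sqrt hμ.le]
  · have hl' : (0 : ℝ) < l := by exact_mod_cast hl
    have h1 : μ ^ l = Real.exp (l * Real.log μ) := by
      rw [mul_comm, Real.exp_mul, Real.exp_log hμ, Real.rpow_natCast]
    have h2 : (l / Real.exp 1) ^ l = Real.exp (l * (Real.log l - 1)) := by
      rw [mul_comm, Real.exp_mul, Real.exp_sub, Real.exp_log hl', Real.rpow_natCast]
    rw [h1, h2, ← Real.exp_add, ← Real.exp_add, Real.exp_le_exp]
    have hs : 0 < √(l : ℝ) := Real.sqrt_pos.2 hl'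
    have ht : 0 < √μ := Real.sqrt_pos.2 hμ
    have h3 := Real.log_le_sub_one_of_pos (div_pos ht hs)
    rw [Real.log_div ht.ne' hs.ne', Real.log_sqrt hμ.le, Real.log_sqrt hl'.le] at h3
    have h4 : (l : ℝ) * (√μ / √l) = √l * √μ := by
      rw [← mul_div_assoc, div_eq_iff hs.ne']
      nlinarith [Real.sq_sqrt hl'.le]
    have h5 := mul_le_mul_of_nonneg_left h3 hl'.le
    have h6 := Real.sq_sqrt hl'.le
    have h7 := Real.sq_sqrt hμ.le
    nlinarith

/-- With `d = |√l - √μ|`, the prefactor `√μ / √(l + 1)` is at most `1 + d`, and half of the exponent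
`d ^ 2` absorbs it. -/
lemma poissonWeight_le {μ : ℝ} (hμ : 0 < μ) (l : ℕ) :
    poissonWeight μ l ≤ √(2 * Real.pi) * (2 * Real.exp (-(√l - √μ) ^ 2 / 2)) := by
  set d := |√(l : ℝ) - √μ| with hd
  have hd2 : (√(l : ℝ) - √μ) ^ 2 = d ^ 2 := (sq_abs _).symm
  have hd0 : 0 ≤ d := abs_nonneg _
  have hpos : 0 < √((l : ℝ) + 1) := Real.sqrt_pos.2 (by positivity)
  have h1 : √μ ≤ (1 + d) * √((l : ℝ) + 1) := by
    have ha : √(l : ℝ) ≤ √((l : ℝ) + 1) := Real.sqrt_le_sqrt (by linarith)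
    have hb : 1 ≤ √((l : ℝ) + 1) := by
      rw [Real.one_le_sqrt]; linarith [Nat.cast_nonneg (α := ℝ) l]
    have hc : -d ≤ √(l : ℝ) - √μ := neg_abs_le _
    nlinarith
  have h2 : (1 + d) * Real.exp (-d ^ 2) ≤ 2 * Real.exp (-d ^ 2 / 2) := by
    have : Real.exp (-d ^ 2) = Real.exp (-d ^ 2 / 2) * Real.exp (-(d ^ 2 / 2)) := by
      rw [← Real.exp_add]; ring_nf
    rw [this]
    have h3 : (1 + d) * Real.exp (-(d ^ 2 / 2)) ≤ 2 := by
      rw [Real.exp_neg, ← div_eq_mul_inv, div_le_iff₀ (Real.exp_pos _)]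
      nlinarith [Real.add_one_le_exp (d ^ 2 / 2), sq_nonneg (d - 1)]
    nlinarith [Real.exp_pos (-d ^ 2 / 2)]
  unfold poissonWeight
  rw [Real.sqrt_mul (by positivity), mul_assoc, hd2]
  refine mul_le_mul_of_nonneg_left ?_ (Real.sqrt_nonneg _)
  refine le_trans ?_ h2
  rw [← mul_div_assoc, div_le_iff₀ (by positivity)]
  calc √μ * (Real.exp (-μ) * μ ^ l)
      ≤ ((1 + d) * √((l : ℝ) + 1)) * ((l / Real.exp 1) ^ l * Real.exp (-d ^ 2)) := by
        rw [← hd2]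
        exact mul_le_mul h1 (exp_neg_mul_pow_le hμ l) (by positivity) (by positivity)
    _ = ((1 + d) * Real.exp (-d ^ 2)) * (√((l : ℝ) + 1) * (l / Real.exp 1) ^ l) := by ring
    _ ≤ _ := by
        gcongr
        exact sqrt_succ_mul_pow_le_factorial l

/-- Gaussian domination of the Poisson weights in a range `l ≤ B μ`. -/
lemma exists_poissonWeight_le_exp (B : ℝ) : ∃ C c : ℝ, 0 < C ∧ 0 < c ∧ ∀ μ : ℝ, 0 < μ → ∀ l : ℕ,
    (l : ℝ) ≤ B * μ → poissonWeight μ l ≤ C * Real.exp (-c * ((l - μ) ^ 2 / μ)) := by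
  have hpi := Real.pi_pos
  refine ⟨√(2 * Real.pi) * 2, (2 * (√B + 1) ^ 2)⁻¹, by positivity, by positivity,
    fun μ hμ l hl => (poissonWeight_le hμ l).trans ?_⟩
  rw [mul_assoc]
  gcongr
  have hB : 0 ≤ B := by
    by_contra h
    have : B * μ < 0 := mul_neg_of_neg_of_pos (not_le.1 h) hμ
    linarith [Nat.cast_nonneg (α := ℝ) l]
  have h1 : √(l : ℝ) ≤ √B * √μ := by
    rw [← Real.sqrt_mul hB]; exact Real.sqrt_le_sqrt hl
  have h2 : (l - μ : ℝ) ^ 2 ≤ (√l - √μ) ^ 2 * ((√B + 1) ^ 2 * μ) := by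
    have e1 : (l - μ : ℝ) = (√l - √μ) * (√l + √μ) := by
      nlinarith [Real.sq_sqrt hμ.le, Real.sq_sqrt (Nat.cast_nonneg (α := ℝ) l)]
    have e2 : (√B + 1) ^ 2 * μ = (√B * √μ + √μ) ^ 2 := by
      nlinarith [Real.sq_sqrt hμ.le]
    rw [e1, mul_pow, e2]
    gcongr
  have h3 : (2 * (√B + 1) ^ 2)⁻¹ * ((l - μ : ℝ) ^ 2 / μ) ≤ (√l - √μ) ^ 2 / 2 := by
    rw [← div_eq_inv_mul, div_div, div_le_iff₀ (by positivity)]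
    nlinarith
  linarith

lemma abs_mul_log_expansion {x : ℝ} (hx : |x| ≤ 1 / 2) :
    |x - (1 + x) * Real.log (1 + x) + x ^ 2 / 2| ≤ 4 * |x| ^ 3 := by
  have h := Real.abs_log_sub_add_sum_range_le (x := -x) (by rw [abs_neg]; linarith) 2
  simp only [Finset.sum_range_succ, Finset.sum_range_zero, abs_neg, sub_neg_eq_add] at h
  have h' : |Real.log (1 + x) - x + x ^ 2 / 2| ≤ 2 * |x| ^ 3 := by
    refine le_trans (le_of_eq ?_) (h.trans ?_)
    · congr 1; norm_num; ring
    · rw [div_le_iff₀ (by linarith)]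
      have := mul_nonneg (pow_nonneg (abs_nonneg x) 3) (sub_nonneg.2 hx)
      norm_num
      linarith
  have e : x - (1 + x) * Real.log (1 + x) + x ^ 2 / 2
      = x ^ 3 / 2 - (1 + x) * (Real.log (1 + x) - x + x ^ 2 / 2) := by ring
  rw [e]
  refine (abs_sub _ _).trans ?_
  rw [abs_mul, abs_div, abs_pow, abs_two]
  have h1 : |1 + x| ≤ 3 / 2 := (abs_add_le _ _).trans (by rw [abs_one]; linarith)
  have := mul_le_mul h1 h' (abs_nonneg _) (by norm_num)
  nlinarith [pow_nonneg (abs_nonneg x) 3]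

/-- The local central limit theorem for Poisson weights. -/
lemma tendsto_poissonWeight {ι : Type*} {F : Filter ι} {μ : ι → ℝ} {l : ι → ℕ} {t : ℝ}
    (hμ : Tendsto μ F atTop)
    (hl : Tendsto (fun i => (l i - μ i) / √(μ i)) F (𝓝 t)) :
    Tendsto (fun i => poissonWeight (μ i) (l i)) F (𝓝 (Real.exp (-(1 / 2) * t ^ 2))) := by
  have hμ0 : ∀ᶠ i in F, 0 < μ i := hμ.eventually_gt_atTop 0
  have hsq : Tendsto (fun i => √(μ i)) F atTop := Real.tendsto_sqrt_atTop.comp hμ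
  set δ : ι → ℝ := fun i => (l i - μ i) / μ i with hδ
  have hδ0 : Tendsto δ F (𝓝 0) := by
    refine (hl.div_atTop hsq).congr' ?_
    filter_upwards [hμ0] with i hi
    rw [hδ, div_div, Real.mul_self_sqrt hi.le]
  have hμδ : Tendsto (fun i => μ i * δ i ^ 2) F (𝓝 (t ^ 2)) := by
    refine (hl.pow 2).congr' ?_
    filter_upwards [hμ0] with i hi
    rw [hδ, div_pow, div_pow, Real.sq_sqrt hi.le]
    field_simp
  have hratio : ∀ᶠ i in F, (l i : ℝ) = μ i * (1 + δ i) := by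
    filter_upwards [hμ0] with i hi
    simp only [hδ]; field_simp; ring
  have h1δ : Tendsto (fun i => 1 + δ i) F (𝓝 1) := by simpa using hδ0.const_add 1
  have hlinf : Tendsto l F atTop := by
    rw [← tendsto_natCast_atTop_iff (R := ℝ)]
    refine (hμ.atTop_mul_pos one_pos h1δ).congr' ?_
    filter_upwards [hratio] with i hi using hi.symm
  have hexp : Tendsto (fun i => μ i * (δ i - (1 + δ i) * Real.log (1 + δ i))) F
      (𝓝 (-(1 / 2) * t ^ 2)) := by
    have hrem : Tendsto (fun i => μ i * (δ i - (1 + δ i) * Real.log (1 + δ i) + δ i ^ 2 / 2)) F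
        (𝓝 0) := by
      refine squeeze_zero_norm' (a := fun i => 4 * (μ i * δ i ^ 2) * |δ i|) ?_ ?_
      · have hsmall : ∀ᶠ i in F, |δ i| < 1 / 2 := by
          have := hδ0.abs
          rw [abs_zero] at this
          exact this.eventually_lt_const (by norm_num)
        filter_upwards [hμ0, hsmall] with i hi hs
        rw [Real.norm_eq_abs, abs_mul, abs_of_pos hi]
        have := mul_le_mul_of_nonneg_left (abs_mul_log_expansion hs.le) hi.le
        refine this.trans (le_of_eq ?_)
        rw [← sq_abs (δ i)]; ring
      · have := (hμδ.const_mul 4).mul hδ0.abs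
        simpa using this
    have := hrem.sub (hμδ.div_const 2)
    refine (this.congr fun i => ?_).trans_eq ?_
    · ring
    · congr 1; ring
  -- With `l = μ (1 + δ)` the weight is exactly the product of a Stirling ratio, the factor `√(1 +
  -- δ)⁻¹` and the exponential treated in `hexp`; the first two tend to `1`.
  have hS : Tendsto (fun i => √Real.pi / Stirling.stirlingSeq (l i)) F (𝓝 1) := by
    have := (tendsto_const_nhds (x := √Real.pi)).div
      (Stirling.tendsto_stirlingSeq_sqrt_pi.comp hlinf) (by positivity)
    rwa [div_self (by positivity)] at this
  have hR : Tendsto (fun i => √(1 + δ i)⁻¹) F (𝓝 1) := by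
    have := (h1δ.inv₀ one_ne_zero).sqrt
    simpa using this
  have hfin := (hS.mul hR).mul (Real.continuous_exp.continuousAt.tendsto.comp hexp)
  rw [one_mul, one_mul] at hfin
  refine hfin.congr' ?_
  filter_upwards [hμ0, hratio, hlinf.eventually_gt_atTop 0] with i hi hr hlp
  have hlp' : (0 : ℝ) < l i := by exact_mod_cast hlp
  have h1p : 0 < 1 + δ i := by
    rw [hr] at hlp'; exact pos_of_mul_pos_right hlp' hi.le
  have hlog : Real.log (1 + δ i) = Real.log (l i) - Real.log (μ i) := by
    rw [hr, Real.log_mul hi.ne' h1p.ne']; ring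
  have hE : Real.exp (μ i * (δ i - (1 + δ i) * Real.log (1 + δ i)))
      = Real.exp (-μ i) * μ i ^ l i / (l i / Real.exp 1) ^ l i := by
    have e1 : μ i ^ l i = Real.exp (l i * Real.log (μ i)) := by
      rw [mul_comm, Real.exp_mul, Real.exp_log hi, Real.rpow_natCast]
    have e2 : (l i / Real.exp 1) ^ l i = Real.exp (l i * (Real.log (l i) - 1)) := by
      rw [mul_comm, Real.exp_mul, Real.exp_sub, Real.exp_log hlp', Real.rpow_natCast]
    rw [e1, e2, ← Real.exp_add, ← Real.exp_sub, hlog]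
    congr 1
    linear_combination (Real.log (l i) - Real.log (μ i) - 1) * hr
  simp only [Function.comp_apply]
  rw [hE, poissonWeight, Stirling.stirlingSeq]
  have hinv : (1 + δ i)⁻¹ = μ i / l i := by rw [hr]; field_simp
  rw [hinv, Real.sqrt_div hi.le, Real.sqrt_mul (by positivity), Real.sqrt_mul (by positivity),
    Real.sqrt_mul (by positivity)]
  have hmm := Real.mul_self_sqrt hlp'.le
  have : 0 < √(l i : ℝ) := Real.sqrt_pos.2 hlp'
  have hpi := Real.pi_pos
  have : (l i / Real.exp 1) ^ l i ≠ 0 := by positivity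
  have h2 : √2 * √2 = (2:ℝ) := Real.mul_self_sqrt (by norm_num)
  generalize (l i / Real.exp 1) ^ l i = X at *
  have h22 : √2 ≠ 0 := by positivity
  field_simp

/-! ### The integral pairing and the embedding of `ℤⁿ`. -/

section Pairing

variable {n : ℕ}

/-- The pairing with an integer vector as a continuous linear form. -/
def pairingL (w : Fin n → ℤ) : E n →L[ℝ] ℝ := ∑ j, (w j : ℝ) • EuclideanSpace.proj j

lemma pairingL_apply (w : Fin n → ℤ) (x : E n) : pairingL w x = pairing w x := by
  simp [pairingL, pairing]

lemma pairing_add (w : Fin n → ℤ) (x y : E n) : pairing w (x + y) = pairing w x + pairing w y := by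
  simp only [← pairingL_apply, map_add]

lemma pairing_sub (w : Fin n → ℤ) (x y : E n) : pairing w (x - y) = pairing w x - pairing w y := by
  simp only [← pairingL_apply, map_sub]

lemma pairing_smul (w : Fin n → ℤ) (c : ℝ) (x : E n) : pairing w (c • x) = c * pairing w x := by
  simp only [← pairingL_apply, map_smul, smul_eq_mul]

lemma pairing_sum {ι : Type*} (s : Finset ι) (w : Fin n → ℤ) (f : ι → E n) :
    pairing w (∑ i ∈ s, f i) = ∑ i ∈ s, pairing w (f i) := by
  simp only [← pairingL_apply, map_sum]

lemma continuous_pairing (w : Fin n → ℤ) : Continuous (pairing w) :=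
  (pairingL w).continuous.congr (pairingL_apply w)

lemma pairing_toReal (w x : Fin n → ℤ) : pairing w (toReal x) = ((w ⬝ᵥ x : ℤ) : ℝ) := by
  simp [pairing, toReal, dotProduct]

lemma sum_pairing {r : ℕ} {v : Fin r → Fin n → ℤ} (hsum : ∑ i, v i = 0) (x : E n) :
    ∑ i, pairing (v i) x = 0 := by
  simp only [pairing]
  rw [Finset.sum_comm]
  refine Finset.sum_eq_zero fun j _ => ?_
  rw [← Finset.sum_mul, ← Int.cast_sum, ← Finset.sum_apply, hsum]
  simp

/-- The embedding of the integer vectors as an additive map. -/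
def toRealHom (n : ℕ) : (Fin n → ℤ) →+ E n where
  toFun := toReal
  map_zero' := by ext; simp [toReal]
  map_add' x y := by ext; simp [toReal]

lemma toReal_add (x y : Fin n → ℤ) : toReal (x + y) = toReal x + toReal y :=
  (toRealHom n).map_add x y

lemma toReal_sub (x y : Fin n → ℤ) : toReal (x - y) = toReal x - toReal y :=
  (toRealHom n).map_sub x y

lemma toReal_sum_smul {ι : Type*} (s : Finset ι) (c : ι → ℤ) (b : ι → Fin n → ℤ) :
    toReal (∑ i ∈ s, c i • b i) = ∑ i ∈ s, (c i : ℝ) • toReal (b i) := by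
  simp only [Int.cast_smul_eq_zsmul]
  exact (map_sum (toRealHom n) (fun i => c i • b i) s).trans
    (Finset.sum_congr rfl fun i _ => map_zsmul (toRealHom n) (c i) (b i))

lemma toReal_injective : Function.Injective (toReal : (Fin n → ℤ) → E n) := by
  intro x y h
  ext j
  have := congrArg (fun z : E n => z j) h
  simpa [toReal] using this

end Pairing

/-! ### Rationality of integral linear systems and lattice bases. -/

section Rational

variable {n : ℕ}

lemma exists_common_denominator (q : Fin n → ℚ) :
    ∃ N : ℕ, 0 < N ∧ ∃ z : Fin n → ℤ, ∀ j, (N : ℚ) * q j = z j := by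
  obtain ⟨b, hb⟩ := IsLocalization.exist_integer_multiples_of_finite (nonZeroDivisors ℤ) q
  choose z hz using hb
  have hb0 : (b : ℤ) ≠ 0 := nonZeroDivisors.coe_ne_zero b
  -- The common denominator `b` may be negative; its sign goes into the numerators.
  refine ⟨(b : ℤ).natAbs, Int.natAbs_pos.2 hb0, fun j => (b : ℤ).sign * z j, fun j => ?_⟩
  have h := hz j
  simp only [eq_intCast, zsmul_eq_mul] at h
  have h2 : (((b : ℤ).natAbs : ℤ) : ℚ) = (((b : ℤ).sign * b : ℤ) : ℚ) := by
    rw [Int.natCast_natAbs, Int.sign_mul_self_eq_abs]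
  rw [Int.cast_natCast] at h2
  rw [h2]
  push_cast
  rw [h]
  ring

/-- A real solution of a homogeneous integral linear system is a combination of integral ones. -/
lemma mem_span_integral_solutions (S : Set (Fin n → ℤ)) (w : E n) (hw : ∀ c ∈ S, pairing c w = 0) :
    w ∈ Submodule.span ℝ (toReal '' {z : Fin n → ℤ | ∀ c ∈ S, c ⬝ᵥ z = 0}) := by
  classical
  -- Expand the coordinates of `w` in a basis of `ℝ` over `ℚ`. The equations have integer
  -- coefficients, so each vector of `β`-coefficients solves them over `ℚ`, and clearing
  -- denominators makes it integral.
  let B := Module.Basis.ofVectorSpace ℚ ℝ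
  have hq : ∀ β, ∃ N : ℕ, 0 < N ∧ ∃ z : Fin n → ℤ, ∀ j, (N : ℚ) * B.repr (w j) β = z j :=
    fun β => exists_common_denominator _
  choose N hN z hz using hq
  have hzS : ∀ β, z β ∈ {z : Fin n → ℤ | ∀ c ∈ S, c ⬝ᵥ z = 0} := by
    intro β c hc
    have h1 : ∑ j, (c j : ℚ) * B.repr (w j) β = 0 := by
      have := congrArg (fun x => B.repr x β) (hw c hc)
      simp only [pairing, map_sum, map_zero, Finsupp.coe_zero, Pi.zero_apply] at this
      rw [Finsupp.finsetSum_apply] at this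
      rw [← this]
      refine Finset.sum_congr rfl fun j _ => ?_
      have : (c j : ℝ) * w j = (c j : ℚ) • w j := by rw [Rat.smul_def]; simp
      rw [this, map_smul, Finsupp.smul_apply, smul_eq_mul]
    have h2 : ((c ⬝ᵥ z β : ℤ) : ℚ) = 0 := by
      simp only [dotProduct, Int.cast_sum, Int.cast_mul, ← hz]
      rw [← mul_zero (N β : ℚ), ← h1, Finset.mul_sum]
      refine Finset.sum_congr rfl fun j _ => by ring
    exact_mod_cast h2
  let T := Finset.univ.biUnion fun j : Fin n => (B.repr (w j)).support
  have hwsum : w = ∑ β ∈ T, (B β / N β) • toReal (z β) := by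
    ext j
    have h1 : w j = ∑ β ∈ T, (B.repr (w j) β) • B β := by
      conv_lhs => rw [← B.linearCombination_repr (w j), Finsupp.linearCombination_apply]
      refine Finsupp.sum_of_support_subset _ ?_ _ (by simp)
      exact Finset.subset_biUnion_of_mem (fun j : Fin n => (B.repr (w j)).support)
        (Finset.mem_univ j)
    rw [h1]
    simp only [WithLp.ofLp_sum, WithLp.ofLp_smul, Finset.sum_apply, Pi.smul_apply, smul_eq_mul,
      toReal]
    refine Finset.sum_congr rfl fun β _ => ?_
    have h2 : ((z β j : ℤ) : ℝ) = N β * ((B.repr (w j) β : ℚ) : ℝ) := by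
      have := congrArg (fun q : ℚ => (q : ℝ)) (hz β j)
      push_cast at this
      exact this.symm
    have h3 : (N β : ℝ) ≠ 0 := by exact_mod_cast (hN β).ne'
    rw [h2, Rat.smul_def]
    field_simp
  rw [hwsum]
  exact Submodule.sum_mem _ fun β _ => Submodule.smul_mem _ _
    (Submodule.subset_span ⟨z β, hzS β, rfl⟩)

/-- If an integral affine system has a real solution, then some dilate of it has an integral one. -/
lemma exists_integral_solution_of_dilate {ι : Type*} (c : ι → Fin n → ℤ) (a : ι → ℤ) (x : E n)
    (hx : ∀ i, pairing (c i) x + a i = 0) :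
    ∃ N : ℕ, 0 < N ∧ ∃ z : Fin n → ℤ, ∀ i, c i ⬝ᵥ z + N * a i = 0 := by
  -- A `ℚ`-linear retraction `ℝ → ℚ` fixes the coefficients of the system, so applied to each
  -- coordinate it turns the real solution into a rational one.
  obtain ⟨f, hf⟩ := LinearMap.exists_leftInverse_of_injective
    (Algebra.linearMap ℚ ℝ) (LinearMap.ker_eq_bot.2 (algebraMap ℚ ℝ).injective)
  have hf1 : ∀ q : ℚ, f (q : ℝ) = q := fun q => by
    simpa using LinearMap.congr_fun hf q
  obtain ⟨N, hN, z, hz⟩ := exists_common_denominator fun j => f (x j)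
  refine ⟨N, hN, z, fun i => ?_⟩
  have h1 : ∑ j, (c i j : ℚ) * f (x j) + a i = 0 := by
    have := congrArg f (hx i)
    simp only [pairing, map_add, map_sum, map_zero] at this
    rw [← this]
    congr 1
    · refine Finset.sum_congr rfl fun j _ => ?_
      have : (c i j : ℝ) * x j = (c i j : ℚ) • x j := by rw [Rat.smul_def]; simp
      rw [this, map_smul, smul_eq_mul]
    · have := hf1 (a i)
      simpa using this.symm
  have h2 : ((c i ⬝ᵥ z + N * a i : ℤ) : ℚ) = 0 := by
    simp only [dotProduct]
    push_cast
    simp only [← hz]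
    rw [← mul_zero (N : ℚ), ← h1, mul_add, Finset.mul_sum]
    congr 1
    refine Finset.sum_congr rfl fun j _ => by ring
  exact_mod_cast h2

/-- A subspace spanned by integral vectors has a basis that is also a `ℤ`-basis of its integral
vectors. -/
lemma exists_lattice_basis (L : Submodule ℝ (E n))
    (hL : L ≤ Submodule.span ℝ (toReal '' {z : Fin n → ℤ | toReal z ∈ L})) :
    ∃ (d : ℕ) (B : Module.Basis (Fin d) ℝ L) (b : Fin d → Fin n → ℤ),
      (∀ j, (B j : E n) = toReal (b j)) ∧
      ∀ z : Fin n → ℤ, toReal z ∈ L → ∃ c : Fin d → ℤ, z = ∑ j, c j • b j := by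
  let e := (EuclideanSpace.basisFun (Fin n) ℝ).toBasis
  have hmem : ∀ x : E n, x ∈ Submodule.span ℤ (Set.range e) ↔ ∃ z : Fin n → ℤ, toReal z = x := by
    intro x
    rw [Module.Basis.mem_span_iff_repr_mem]
    constructor
    · intro h
      choose z hz using h
      refine ⟨z, ?_⟩
      ext j
      have := hz j
      simpa [toReal, e] using this
    · rintro ⟨z, rfl⟩ j
      exact ⟨z j, by simp [toReal, e]⟩
  -- `Λ` is `L ∩ ℤⁿ`. It is discrete, and `hL` says that it spans `L`, so a `ℤ`-basis of it is also
  -- an `ℝ`-basis of `L`.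
  let Λ : Submodule ℤ L := (Submodule.span ℤ (Set.range e)).comap (L.subtype.restrictScalars ℤ)
  have hΛ : ∀ x : L, x ∈ Λ ↔ ∃ z : Fin n → ℤ, toReal z = x := fun x => hmem x
  have : DiscreteTopology Λ := by
    let f : Λ → Submodule.span ℤ (Set.range e) := fun x => ⟨x.1, x.2⟩
    refine DiscreteTopology.of_continuous_injective (f := f) ?_ ?_
    · exact Continuous.subtype_mk (continuous_subtype_val.comp continuous_subtype_val) _
    · intro x y h
      have := congrArg Subtype.val h
      exact Subtype.ext (Subtype.ext this)
  have : IsZLattice ℝ Λ := by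
    constructor
    rw [eq_top_iff]
    rintro ⟨x, hx⟩ -
    have h1 : (L.subtype '' (Λ : Set L)) = toReal '' {z : Fin n → ℤ | toReal z ∈ L} := by
      ext y
      constructor
      · rintro ⟨y, hy, rfl⟩
        obtain ⟨z, hz⟩ := (hΛ y).1 hy
        exact ⟨z, by simp [hz], hz⟩
      · rintro ⟨z, hz, rfl⟩
        exact ⟨⟨toReal z, hz⟩, (hΛ _).2 ⟨z, rfl⟩, rfl⟩
    have h2 := hL hx
    rw [← h1, ← Submodule.map_span] at h2
    obtain ⟨y, hy, hyx⟩ := h2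
    have : y = ⟨x, hx⟩ := Subtype.ext hyx
    rwa [← this]
  let b0 := Module.Free.chooseBasis ℤ Λ
  let b1 := b0.reindex (Fintype.equivFin _)
  refine ⟨_, b1.ofZLatticeBasis ℝ Λ, ?_⟩
  have hb : ∀ j, ∃ z : Fin n → ℤ, toReal z = (b1 j : L) := fun j => (hΛ _).1 (b1 j).2
  choose b hb using hb
  refine ⟨b, fun j => ?_, fun z hz => ?_⟩
  · rw [Module.Basis.ofZLatticeBasis_apply, hb]
  · let x : Λ := ⟨⟨toReal z, hz⟩, (hΛ _).2 ⟨z, rfl⟩⟩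
    refine ⟨fun j => b1.repr x j, toReal_injective ?_⟩
    have h := congrArg (fun y : Λ => ((y : L) : E n)) (b1.sum_repr x)
    simp only [Submodule.coe_sum, Submodule.coe_smul] at h
    rw [toReal_sum_smul]
    simp only [hb, Int.cast_smul_eq_zsmul]
    exact h.symm

end Rational

/-! ### Geometry of `P`, the minimizer, and the quadratic form. -/

section Polytope

variable {n r : ℕ} {v : Fin r → Fin n → ℤ} {a : Fin r → ℤ}

/-- The affine form `⟨v_i, x⟩ + a_i`. -/
def gap (v : Fin r → Fin n → ℤ) (a : Fin r → ℤ) (i : Fin r) (x : E n) : ℝ :=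
  pairing (v i) x + a i

lemma mem_polyhedron {x : E n} : x ∈ polyhedron v a ↔ ∀ i, 0 ≤ gap v a i x := by
  simp [polyhedron, gap]

lemma gap_add (i : Fin r) (x w : E n) : gap v a i (x + w) = gap v a i x + pairing (v i) w := by
  simp only [gap, pairing_add]; ring

lemma gap_combo (i : Fin r) (x y : E n) {s t : ℝ} (hst : s + t = 1) :
    gap v a i (s • x + t • y) = s * gap v a i x + t * gap v a i y := by
  simp only [gap, pairing_add, pairing_smul]
  linear_combination -(a i : ℝ) * hst

lemma gap_sub_gap (i : Fin r) (x y : E n) :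
    gap v a i x - gap v a i y = pairing (v i) (x - y) := by
  simp only [gap, pairing_sub]; ring

lemma continuous_gap (i : Fin r) : Continuous (gap v a i) :=
  (continuous_pairing _).add continuous_const

lemma sum_gap (hsum : ∑ i, v i = 0) (x : E n) : ∑ i, gap v a i x = ∑ i, (a i : ℝ) := by
  simp only [gap, Finset.sum_add_distrib, sum_pairing hsum, zero_add]

lemma convex_polyhedron : Convex ℝ (polyhedron v a) := by
  intro x hx y hy s t hs ht hst
  rw [mem_polyhedron] at *
  intro i
  rw [gap_combo i x y hst]
  exact add_nonneg (mul_nonneg hs (hx i)) (mul_nonneg ht (hy i))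

lemma mem_nonconstIndices {i : Fin r} : i ∈ nonconstIndices v a ↔
    ∃ x ∈ polyhedron v a, ∃ y ∈ polyhedron v a, pairing (v i) x ≠ pairing (v i) y := by
  simp [nonconstIndices]

lemma polyhedron_nonempty (htouch : ∀ i, (hyperplane v a i ∩ polyhedron v a).Nonempty) :
    (polyhedron v a).Nonempty := by
  rcases isEmpty_or_nonempty (Fin r) with h | ⟨⟨i⟩⟩
  · exact ⟨0, mem_polyhedron.2 fun i => h.elim i⟩
  · exact (htouch i).mono Set.inter_subset_right

/-- The form is constant on `P` and vanishes where `H_i` meets `P`. -/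
lemma gap_eq_zero (htouch : ∀ i, (hyperplane v a i ∩ polyhedron v a).Nonempty) {i : Fin r}
    (hi : i ∉ nonconstIndices v a) {x : E n} (hx : x ∈ polyhedron v a) : gap v a i x = 0 := by
  obtain ⟨y, hy, hyP⟩ := htouch i
  have : pairing (v i) x = pairing (v i) y := by
    by_contra h
    exact hi (mem_nonconstIndices.2 ⟨x, hx, y, hyP, h⟩)
  rw [gap, this]
  exact hy

/-- A nonconstant nonnegative form is positive somewhere on `P`, and taking a midpoint keeps every
positivity already obtained. -/
lemma exists_gap_pos (hne : (polyhedron v a).Nonempty) :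
    ∃ p ∈ polyhedron v a, ∀ i ∈ nonconstIndices v a, 0 < gap v a i p := by
  suffices ∀ S ⊆ nonconstIndices v a, ∃ p ∈ polyhedron v a, ∀ i ∈ S, 0 < gap v a i p from
    this _ subset_rfl
  intro S
  induction S using Finset.induction_on with
  | empty => exact fun _ => hne.imp fun p hp => ⟨hp, by simp⟩
  | insert i S _ ih =>
    intro hS
    obtain ⟨p, hp, hpS⟩ := ih ((Finset.subset_insert _ _).trans hS)
    obtain ⟨q, hq, hqi⟩ : ∃ q ∈ polyhedron v a, 0 < gap v a i q := by
      obtain ⟨x, hx, y, hy, hxy⟩ := mem_nonconstIndices.1 (hS (Finset.mem_insert_self _ _))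
      by_contra! h
      have h1 := le_antisymm (h x hx) (mem_polyhedron.1 hx i)
      have h2 := le_antisymm (h y hy) (mem_polyhedron.1 hy i)
      rw [gap] at h1 h2
      exact hxy (by linarith)
    refine ⟨(1 / 2 : ℝ) • p + (1 / 2 : ℝ) • q,
      convex_polyhedron hp hq (by norm_num) (by norm_num) (by norm_num), fun j hj => ?_⟩
    rw [gap_combo j p q (by norm_num)]
    have hpj := mem_polyhedron.1 hp j
    have hqj := mem_polyhedron.1 hq j
    rcases Finset.mem_insert.1 hj with rfl | hj
    · linarith
    · linarith [hpS j hj]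

/-- Otherwise `P` would contain a whole line in the direction `w`, contradicting boundedness. -/
lemma eq_zero_of_pairing_eq_zero (hcompact : IsCompact (polyhedron v a))
    (hne : (polyhedron v a).Nonempty) {w : E n} (hw : ∀ i, pairing (v i) w = 0) : w = 0 := by
  obtain ⟨p, hp⟩ := hne
  obtain ⟨R, hR⟩ := hcompact.isBounded.exists_norm_le
  by_contra h
  have hwpos : 0 < ‖w‖ := norm_pos_iff.2 h
  have hmem : ∀ t : ℝ, p + t • w ∈ polyhedron v a := fun t => by
    refine mem_polyhedron.2 fun i => ?_
    rw [gap_add, pairing_smul, hw, mul_zero, add_zero]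
    exact mem_polyhedron.1 hp i
  have h1 := hR _ (hmem ((R + ‖p‖ + 1) / ‖w‖))
  have h2 : ‖((R + ‖p‖ + 1) / ‖w‖) • w‖ = |R + ‖p‖ + 1| := by
    rw [norm_smul, Real.norm_eq_abs, abs_div, abs_of_pos hwpos, div_mul_cancel₀ _ hwpos.ne']
  have h3 := norm_sub_le (p + ((R + ‖p‖ + 1) / ‖w‖) • w) p
  rw [add_sub_cancel_left, h2] at h3
  linarith [le_abs_self (R + ‖p‖ + 1)]

/-- The logarithm of the potential. -/
def logPotential (v : Fin r → Fin n → ℤ) (a : Fin r → ℤ) (x : E n) : ℝ :=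
  ∑ i, gap v a i x * Real.log (gap v a i x)

lemma potential_eq_exp {x : E n} (hx : x ∈ polyhedron v a) :
    potential v a x = Real.exp (logPotential v a x) := by
  rw [logPotential, Real.exp_sum, potential]
  refine Finset.prod_congr rfl fun i _ => ?_
  change gap v a i x ^ gap v a i x = _
  rcases (mem_polyhedron.1 hx i).eq_or_lt with h | h
  · simp [← h]
  · rw [Real.rpow_def_of_pos h, mul_comm]

lemma isMinOn_potential_iff {m : E n} (hm : m ∈ polyhedron v a) :
    IsMinOn (potential v a) (polyhedron v a) m ↔
      IsMinOn (logPotential v a) (polyhedron v a) m := by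
  simp only [isMinOn_iff]
  refine forall₂_congr fun x hx => ?_
  rw [potential_eq_exp hx, potential_eq_exp hm, Real.exp_le_exp]

lemma continuous_logPotential : Continuous (logPotential v a) :=
  continuous_finsetSum _ fun i _ => Real.continuous_mul_log.comp (continuous_gap i)

lemma logPotential_combo_le {x y : E n} (hx : x ∈ polyhedron v a) (hy : y ∈ polyhedron v a)
    (i : Fin r) {s t : ℝ} (hs : 0 ≤ s) (ht : 0 ≤ t) (hst : s + t = 1) :
    gap v a i (s • x + t • y) * Real.log (gap v a i (s • x + t • y)) ≤
      s * (gap v a i x * Real.log (gap v a i x)) + t * (gap v a i y * Real.log (gap v a i y)) := by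
  rw [gap_combo i x y hst]
  exact Real.convexOn_mul_log.2 (mem_polyhedron.1 hx i) (mem_polyhedron.1 hy i) hs ht hst

/-- The forms separate points because `P` contains no line, so `u log u` is strictly convex between
the two minimizers in at least one summand, and their midpoint would do better. -/
lemma isMinOn_logPotential_unique (hcompact : IsCompact (polyhedron v a)) {m m' : E n}
    (hm : m ∈ polyhedron v a) (hm' : m' ∈ polyhedron v a)
    (hmin : IsMinOn (logPotential v a) (polyhedron v a) m)
    (hmin' : IsMinOn (logPotential v a) (polyhedron v a) m') : m' = m := by
  by_contra hne
  obtain ⟨i, hi⟩ : ∃ i, gap v a i m' ≠ gap v a i m := by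
    by_contra! h
    refine hne (sub_eq_zero.1 (eq_zero_of_pairing_eq_zero hcompact ⟨m, hm⟩ fun i => ?_))
    rw [← gap_sub_gap (a := a), h i, sub_self]
  have hlt : logPotential v a ((1 / 2 : ℝ) • m' + (1 / 2 : ℝ) • m) <
      ∑ i, ((1 / 2) * (gap v a i m' * Real.log (gap v a i m')) +
        (1 / 2) * (gap v a i m * Real.log (gap v a i m))) := by
    have half : (0 : ℝ) ≤ 1 / 2 := by norm_num
    refine Finset.sum_lt_sum (fun j _ => logPotential_combo_le hm' hm j half half
      (add_halves 1)) ⟨i, Finset.mem_univ i, ?_⟩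
    rw [gap_combo i m' m (by norm_num)]
    exact Real.strictConvexOn_mul_log.2 (mem_polyhedron.1 hm' i) (mem_polyhedron.1 hm i) hi
      (by norm_num) (by norm_num) (by norm_num)
  rw [Finset.sum_add_distrib, ← Finset.mul_sum, ← Finset.mul_sum] at hlt
  change _ < 1 / 2 * logPotential v a m' + 1 / 2 * logPotential v a m at hlt
  have hmid : (1 / 2 : ℝ) • m' + (1 / 2 : ℝ) • m ∈ polyhedron v a :=
    convex_polyhedron hm' hm (by norm_num) (by norm_num) (by norm_num)
  have h1 := isMinOn_iff.1 hmin _ hmid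
  have h2 := isMinOn_iff.1 hmin' _ hm
  have h3 := isMinOn_iff.1 hmin _ hm'
  linarith

/-- Since `u log u` has infinite slope at `0`, a minimizer does not lie on a proper face. -/
lemma gap_pos_of_isMinOn {m : E n} (hm : m ∈ polyhedron v a)
    (hmin : IsMinOn (logPotential v a) (polyhedron v a) m) {i : Fin r}
    (hi : i ∈ nonconstIndices v a) : 0 < gap v a i m := by
  obtain ⟨p, hp, hpos⟩ := exists_gap_pos ⟨m, hm⟩
  refine (mem_polyhedron.1 hm i).lt_of_ne fun h0 => ?_
  -- Compare `m` with `(1 - t) m + t p`, using convexity in every summand except the `i`-th, whose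
  -- value is exactly `t g log (t g)` for `g = gap v a i p`. After division by `t` the term `g log
  -- t` remains, which tends to `-∞`.
  have key : ∀ t : ℝ, 0 < t → t ≤ 1 →
      logPotential v a m ≤ logPotential v a p + gap v a i p * Real.log t := by
    intro t ht ht1
    have h1 := isMinOn_iff.1 hmin _ (convex_polyhedron hm hp (sub_nonneg.2 ht1) ht.le
      (sub_add_cancel 1 t))
    have h2 : logPotential v a ((1 - t) • m + t • p) ≤
        ∑ j, ((1 - t) * (gap v a j m * Real.log (gap v a j m)) +
          t * (gap v a j p * Real.log (gap v a j p)) +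
          if j = i then t * (gap v a i p * Real.log t) else 0) := by
      refine Finset.sum_le_sum fun j _ => ?_
      split_ifs with hj
      · subst hj
        rw [gap_combo j m p (sub_add_cancel 1 t), ← h0, mul_zero, zero_add,
          Real.log_mul ht.ne' (hpos j hi).ne']
        apply le_of_eq; ring
      · rw [add_zero]
        exact logPotential_combo_le hm hp j (sub_nonneg.2 ht1) ht.le (sub_add_cancel 1 t)
    rw [Finset.sum_add_distrib, Finset.sum_add_distrib, ← Finset.mul_sum, ← Finset.mul_sum,
      Finset.sum_ite_eq' Finset.univ i, if_pos (Finset.mem_univ i)] at h2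
    have h3 := h1.trans h2
    change _ ≤ (1 - t) * logPotential v a m + t * logPotential v a p + _ at h3
    have h4 : t * logPotential v a m ≤
        t * (logPotential v a p + gap v a i p * Real.log t) := by linarith
    exact le_of_mul_le_mul_left h4 ht
  have hlim : Tendsto (fun t => logPotential v a p + gap v a i p * Real.log t) (𝓝[>] 0) atBot :=
    tendsto_atBot_add_const_left _ _
      (Real.tendsto_log_nhdsGT_zero.const_mul_atBot (hpos i hi))
  have hev := hlim.eventually_lt_atBot (logPotential v a m)
  have h01 : ∀ᶠ t : ℝ in 𝓝[>] 0, t ∈ Set.Ioc (0 : ℝ) 1 := Ioc_mem_nhdsGT one_pos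
  obtain ⟨t, ht, ht'⟩ := (hev.and h01).exists
  exact absurd (key t ht'.1 ht'.2) (not_le.2 ht)

lemma exists_isMinOn_logPotential (hcompact : IsCompact (polyhedron v a))
    (hne : (polyhedron v a).Nonempty) :
    ∃ m ∈ polyhedron v a, IsMinOn (logPotential v a) (polyhedron v a) m :=
  hcompact.exists_isMinOn hne continuous_logPotential.continuousOn

lemma pairing_eq_zero_of_mem_directionSpace
    (htouch : ∀ i, (hyperplane v a i ∩ polyhedron v a).Nonempty) {w : E n}
    (hw : w ∈ directionSpace v a) {i : Fin r} (hi : i ∉ nonconstIndices v a) :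
    pairing (v i) w = 0 := by
  have : directionSpace v a ≤ LinearMap.ker (pairingL (v i)).toLinearMap := by
    refine Submodule.span_le.2 ?_
    rintro _ ⟨x, hx, y, hy, rfl⟩
    change pairingL (v i) (x - y) = 0
    rw [pairingL_apply, ← gap_sub_gap (a := a), gap_eq_zero htouch hi hx,
      gap_eq_zero htouch hi hy, sub_zero]
  have h := this hw
  change pairingL (v i) w = 0 at h
  rwa [pairingL_apply] at h

lemma eventually_add_smul_mem {m : E n} (hm : m ∈ polyhedron v a)
    (hpos : ∀ i ∈ nonconstIndices v a, 0 < gap v a i m)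
    {w : E n} (hw : ∀ i ∉ nonconstIndices v a, pairing (v i) w = 0) :
    ∀ᶠ t : ℝ in 𝓝 0, m + t • w ∈ polyhedron v a := by
  simp only [mem_polyhedron, eventually_all]
  intro i
  by_cases hi : i ∈ nonconstIndices v a
  · have hc : Continuous fun t : ℝ => gap v a i (m + t • w) :=
      (continuous_gap i).comp (by fun_prop)
    have := hc.tendsto 0
    rw [zero_smul, add_zero] at this
    exact (this.eventually_const_lt (hpos i hi)).mono fun t ht => ht.le
  · refine Eventually.of_forall fun t => ?_
    rw [gap_add, pairing_smul, hw i hi, mul_zero, add_zero]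
    exact mem_polyhedron.1 hm i

/-- Forms constant on `P` kill differences of its points. Conversely, from a point where all other
forms are positive, a short step along `w` stays in `P`. -/
lemma mem_directionSpace_iff (htouch : ∀ i, (hyperplane v a i ∩ polyhedron v a).Nonempty)
    {w : E n} : w ∈ directionSpace v a ↔ ∀ i ∉ nonconstIndices v a, pairing (v i) w = 0 := by
  refine ⟨fun hw i hi => pairing_eq_zero_of_mem_directionSpace htouch hw hi, fun hw => ?_⟩
  obtain ⟨p, hp, hpos⟩ := exists_gap_pos (polyhedron_nonempty htouch)
  have h1 := (eventually_add_smul_mem hp hpos hw).filter_mono (nhdsWithin_le_nhds (s := {0}ᶜ))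
  obtain ⟨t, ht, ht0⟩ := (h1.and self_mem_nhdsWithin).exists
  have h2 : t • w ∈ directionSpace v a := by
    have := vsub_mem_vectorSpan ℝ ht hp
    rwa [vsub_eq_sub, add_sub_cancel_left] at this
  exact ((directionSpace v a).smul_mem_iff ht0).1 h2

/-- Within the affine span the forms constant on `P` vanish identically, so the strict inequalities
for the others define a relatively open subset of `P`. -/
lemma mem_intrinsicInterior_of_gap_pos
    (htouch : ∀ i, (hyperplane v a i ∩ polyhedron v a).Nonempty) {m : E n}
    (hm : m ∈ polyhedron v a) (hpos : ∀ i ∈ nonconstIndices v a, 0 < gap v a i m) :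
    m ∈ intrinsicInterior ℝ (polyhedron v a) := by
  rw [mem_intrinsicInterior]
  refine ⟨⟨m, subset_affineSpan ℝ _ hm⟩, ?_, rfl⟩
  rw [mem_interior]
  refine ⟨{x | ∀ i ∈ nonconstIndices v a, 0 < gap v a i x}, fun x hx => ?_, ?_, hpos⟩
  · refine mem_polyhedron.2 fun i => ?_
    by_cases hi : i ∈ nonconstIndices v a
    · exact (hx i hi).le
    · have h1 : (x : E n) - m ∈ directionSpace v a := by
        have := AffineSubspace.vsub_mem_direction x.2 (subset_affineSpan ℝ _ hm)
        rwa [direction_affineSpan] at this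
      have h2 := pairing_eq_zero_of_mem_directionSpace htouch h1 hi
      rw [← gap_sub_gap (a := a), gap_eq_zero htouch hi hm, sub_zero] at h2
      exact h2.ge
  · simp only [Set.ofPred_forall]
    refine isOpen_biInter_finset fun i _ => ?_
    exact isOpen_lt continuous_const ((continuous_gap i).comp continuous_subtype_val)

/-- The critical point equation of the potential. -/
lemma sum_pairing_mul_log_eq_zero (hsum : ∑ i, v i = 0)
    (htouch : ∀ i, (hyperplane v a i ∩ polyhedron v a).Nonempty) {m : E n}
    (hm : m ∈ polyhedron v a) (hmin : IsMinOn (logPotential v a) (polyhedron v a) m) {w : E n}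
    (hw : w ∈ directionSpace v a) :
    ∑ i, pairing (v i) w * Real.log (gap v a i m) = 0 := by
  have hpos : ∀ i ∈ nonconstIndices v a, 0 < gap v a i m :=
    fun i hi => gap_pos_of_isMinOn hm hmin hi
  have hw' := (mem_directionSpace_iff htouch).1 hw
  have hloc : IsLocalMin (fun t : ℝ => logPotential v a (m + t • w)) 0 := by
    refine (eventually_add_smul_mem hm hpos hw').mono fun t ht => ?_
    simpa using isMinOn_iff.1 hmin _ ht
  have hder : HasDerivAt (fun t : ℝ => logPotential v a (m + t • w))
      (∑ i, pairing (v i) w * (Real.log (gap v a i m) + 1)) 0 := by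
    simp only [logPotential]
    refine HasDerivAt.fun_sum fun i _ => ?_
    by_cases hi : i ∈ nonconstIndices v a
    · have h1 : HasDerivAt (fun t : ℝ => gap v a i (m + t • w)) (pairing (v i) w) 0 := by
        simp only [gap_add, pairing_smul]
        simpa using ((hasDerivAt_id (0 : ℝ)).mul_const (pairing (v i) w)).const_add (gap v a i m)
      have h2 : HasDerivAt (fun u : ℝ => u * Real.log u) (Real.log (gap v a i m) + 1)
          (gap v a i (m + (0 : ℝ) • w)) := by
        rw [zero_smul, add_zero]
        exact Real.hasDerivAt_mul_log (hpos i hi).ne'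
      have := h2.comp (0 : ℝ) h1
      rw [mul_comm] at this
      exact this
    -- Here the form is `0` along the whole line, so `u log u` is never differentiated at `0`.
    · simp only [gap_add, pairing_smul, hw' i hi, gap_eq_zero htouch hi hm, mul_zero, zero_mul,
        add_zero]
      exact hasDerivAt_const _ _
  have h := hloc.hasDerivAt_eq_zero hder
  -- The `+ 1` in the derivative of `u log u` drops out because `∑ v_i = 0`.
  simp only [mul_add, mul_one, Finset.sum_add_distrib, sum_pairing hsum, add_zero] at h
  exact h

lemma exists_pairing_ne_zero (hcompact : IsCompact (polyhedron v a))
    (htouch : ∀ i, (hyperplane v a i ∩ polyhedron v a).Nonempty) {w : E n}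
    (hw : w ∈ directionSpace v a) (hw0 : w ≠ 0) :
    ∃ i ∈ nonconstIndices v a, pairing (v i) w ≠ 0 := by
  by_contra! h
  refine hw0 (eq_zero_of_pairing_eq_zero hcompact (polyhedron_nonempty htouch) fun i => ?_)
  by_cases hi : i ∈ nonconstIndices v a
  · exact h i hi
  · exact (mem_directionSpace_iff htouch).1 hw i hi

lemma quadForm_pos (hcompact : IsCompact (polyhedron v a))
    (htouch : ∀ i, (hyperplane v a i ∩ polyhedron v a).Nonempty) {m : E n}
    (hpos : ∀ i ∈ nonconstIndices v a, 0 < gap v a i m) {w : E n}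
    (hw : w ∈ directionSpace v a) (hw0 : w ≠ 0) : 0 < quadForm v a m w := by
  obtain ⟨i, hi, hiw⟩ := exists_pairing_ne_zero hcompact htouch hw hw0
  refine Finset.sum_pos' (fun j hj => ?_) ⟨i, hi, ?_⟩
  · exact div_nonneg (sq_nonneg _) (hpos j hj).le
  · exact div_pos (by positivity) (hpos i hi)

/-- `L` is the solution space of the integral equations given by the forms constant on `P`, hence is
spanned by integral vectors. -/
lemma directionSpace_le_span (htouch : ∀ i, (hyperplane v a i ∩ polyhedron v a).Nonempty) :
    directionSpace v a ≤
      Submodule.span ℝ (toReal '' {z : Fin n → ℤ | toReal z ∈ directionSpace v a}) := by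
  intro w hw
  have := mem_span_integral_solutions (v '' {i | i ∉ nonconstIndices v a}) w (by
    rintro _ ⟨i, hi, rfl⟩
    exact (mem_directionSpace_iff htouch).1 hw i hi)
  refine Submodule.span_mono (Set.image_mono fun z hz => ?_) this
  refine (mem_directionSpace_iff htouch).2 fun i hi => ?_
  rw [pairing_toReal, hz (v i) ⟨i, hi, rfl⟩, Int.cast_zero]

end Polytope

/-! ### Lattice points of `k P` and the Poisson form of the weight. -/

section Dilates

variable {n r : ℕ} {v : Fin r → Fin n → ℤ} {a : Fin r → ℤ}

lemma gap_nsmul_smul (k : ℕ) (i : Fin r) (x : E n) :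
    gap v (k • a) i ((k : ℝ) • x) = k * gap v a i x := by
  simp [gap, pairing_smul, mul_add]

lemma gap_toReal (i : Fin r) (x : Fin n → ℤ) :
    gap v a i (toReal x) = ((v i ⬝ᵥ x + a i : ℤ) : ℝ) := by
  rw [gap, pairing_toReal]; push_cast; rfl

lemma smul_inv_mem_polyhedron {k : ℕ} (hk : 0 < k) {x : E n} (hx : x ∈ polyhedron v (k • a)) :
    (k : ℝ)⁻¹ • x ∈ polyhedron v a := by
  have hk' : (0 : ℝ) < k := by exact_mod_cast hk
  refine mem_polyhedron.2 fun i => ?_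
  have h := mem_polyhedron.1 hx i
  have e : x = (k : ℝ) • ((k : ℝ)⁻¹ • x) := by rw [smul_inv_smul₀ hk'.ne']
  rw [e, gap_nsmul_smul] at h
  exact nonneg_of_mul_nonneg_right h hk'

lemma gap_nsmul_eq_zero (htouch : ∀ i, (hyperplane v a i ∩ polyhedron v a).Nonempty) {k : ℕ}
    (hk : 0 < k) {x : E n} (hx : x ∈ polyhedron v (k • a)) {i : Fin r}
    (hi : i ∉ nonconstIndices v a) : gap v (k • a) i x = 0 := by
  have hk' : (0 : ℝ) < k := by exact_mod_cast hk
  have e : x = (k : ℝ) • ((k : ℝ)⁻¹ • x) := by rw [smul_inv_smul₀ hk'.ne']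
  rw [e, gap_nsmul_smul, gap_eq_zero htouch hi (smul_inv_mem_polyhedron hk hx), mul_zero]

lemma smul_sub_mem_directionSpace (htouch : ∀ i, (hyperplane v a i ∩ polyhedron v a).Nonempty)
    {m : E n} (hm : m ∈ polyhedron v a) {k : ℕ} {x : E n}
    (hx : ∀ i ∉ nonconstIndices v a, gap v (k • a) i x = 0) :
    (k : ℝ) • m - x ∈ directionSpace v a := by
  refine (mem_directionSpace_iff htouch).2 fun i hi => ?_
  rw [← gap_sub_gap (a := k • a), hx i hi, gap_nsmul_smul, gap_eq_zero htouch hi hm, mul_zero,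
    sub_zero]

lemma finite_latticePoints (hcompact : IsCompact (polyhedron v a)) {k : ℕ} (hk : 0 < k) :
    (latticePoints v (k • a)).Finite := by
  have hk' : (0 : ℝ) < k := by exact_mod_cast hk
  obtain ⟨R, hR⟩ := hcompact.isBounded.exists_norm_le
  refine (Set.finite_Icc (fun _ : Fin n => -⌈k * R⌉) (fun _ => ⌈k * R⌉)).subset fun x hx => ?_
  have h1 := hR _ (smul_inv_mem_polyhedron hk hx)
  rw [norm_smul, norm_inv, Real.norm_natCast, inv_mul_le_iff₀ hk'] at h1
  have h2 : ∀ j, |x j| ≤ ⌈k * R⌉ := fun j => by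
    have h3 := (PiLp.norm_apply_le (toReal x) j).trans (h1.trans (Int.le_ceil _))
    rw [Real.norm_eq_abs] at h3
    have h4 : |((x j : ℤ) : ℝ)| ≤ (⌈k * R⌉ : ℤ) := h3
    exact_mod_cast h4
  exact ⟨fun j => (abs_le.1 (h2 j)).1, fun j => (abs_le.1 (h2 j)).2⟩

/-- The product of rescaled Poisson weights to which the multinomial weight is proportional. -/
def productWeight (v : Fin r → Fin n → ℤ) (a : Fin r → ℤ) (m : E n) (k : ℕ) (x : Fin n → ℤ) : ℝ :=
  ∏ i ∈ nonconstIndices v a, poissonWeight (k * gap v a i m) (v i ⬝ᵥ x + (k • a) i).toNat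

lemma natCast_toNat_eq_gap {x : Fin n → ℤ} (hx : x ∈ latticePoints v a) (i : Fin r) :
    (((v i ⬝ᵥ x + a i).toNat : ℕ) : ℝ) = gap v a i (toReal x) := by
  have h := mem_polyhedron.1 hx i
  rw [gap_toReal] at h ⊢
  have h' : 0 ≤ v i ⬝ᵥ x + a i := by exact_mod_cast h
  exact_mod_cast Int.toNat_of_nonneg h'

/-- Here the minimality of `m` enters the probability. Both sides have `∏ l_i!` in the denominator.
The numerators `(∑ l_i)!` and `∏ (k g_i) ^ l_i` are constant on the lattice points, by `∑ v_i = 0`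
and the critical point equation. -/
lemma exists_weight_eq_mul_productWeight (hsum : ∑ i, v i = 0)
    (htouch : ∀ i, (hyperplane v a i ∩ polyhedron v a).Nonempty) {m : E n}
    (hm : m ∈ polyhedron v a) (hmin : IsMinOn (logPotential v a) (polyhedron v a) m) {k : ℕ}
    (hk : 0 < k) {x₀ : Fin n → ℤ} (hx₀ : x₀ ∈ latticePoints v (k • a)) :
    ∃ C : ℝ, 0 < C ∧ ∀ x ∈ latticePoints v (k • a),
      (weight v (k • a) x : ℝ) = C * productWeight v a m k x := by
  classical
  have hk' : (0 : ℝ) < k := by exact_mod_cast hk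
  set I := nonconstIndices v a with hI
  have hpos : ∀ i ∈ I, 0 < gap v a i m := fun i hi => gap_pos_of_isMinOn hm hmin hi
  have hkpos : ∀ i ∈ I, 0 < k * gap v a i m := fun i hi => mul_pos hk' (hpos i hi)
  let l : (Fin n → ℤ) → Fin r → ℕ := fun x i => (v i ⬝ᵥ x + (k • a) i).toNat
  have hl : ∀ x ∈ latticePoints v (k • a), ∀ i, (l x i : ℝ) = gap v (k • a) i (toReal x) :=
    fun x hx i => natCast_toNat_eq_gap hx i
  have hl0 : ∀ x ∈ latticePoints v (k • a), ∀ i ∉ I, l x i = 0 := fun x hx i hi => by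
    have := hl x hx i
    rw [gap_nsmul_eq_zero htouch hk hx hi] at this
    exact_mod_cast this
  have hN : ∀ x ∈ latticePoints v (k • a), ∑ i, l x i = ∑ i, l x₀ i := fun x hx => by
    have : (∑ i, (l x i : ℝ)) = ∑ i, (l x₀ i : ℝ) := by
      simp only [hl x hx, hl x₀ hx₀, sum_gap hsum]
    exact_mod_cast this
  have hprod : ∀ x ∈ latticePoints v (k • a), ∏ i ∈ I, (k * gap v a i m) ^ l x i =
      ∏ i ∈ I, (k * gap v a i m) ^ l x₀ i := fun x hx => by
    have hexp : ∀ y, ∏ i ∈ I, (k * gap v a i m) ^ l y i =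
        Real.exp (∑ i ∈ I, l y i * (Real.log k + Real.log (gap v a i m))) := fun y => by
      rw [Real.exp_sum]
      refine Finset.prod_congr rfl fun i hi => ?_
      rw [← Real.log_mul hk'.ne' (hpos i hi).ne', mul_comm (l y i : ℝ), Real.exp_mul,
        Real.exp_log (hkpos i hi), Real.rpow_natCast]
    rw [hexp, hexp, Real.exp_eq_exp, ← sub_eq_zero, ← Finset.sum_sub_distrib]
    have hw : toReal x - toReal x₀ ∈ directionSpace v a := by
      refine (mem_directionSpace_iff htouch).2 fun i hi => ?_
      rw [← gap_sub_gap (a := k • a), gap_nsmul_eq_zero htouch hk hx hi,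
        gap_nsmul_eq_zero htouch hk hx₀ hi, sub_zero]
    have h1 := sum_pairing_mul_log_eq_zero hsum htouch hm hmin hw
    have h2 := sum_pairing hsum (toReal x - toReal x₀)
    -- The `log k` part cancels by `∑ v_i = 0`, the rest by the critical point equation.
    have h3 : ∑ i, pairing (v i) (toReal x - toReal x₀) *
        (Real.log k + Real.log (gap v a i m)) = 0 := by
      simp only [mul_add, Finset.sum_add_distrib, h1, ← Finset.sum_mul, h2, zero_mul, add_zero]
    rw [← Finset.sum_subset (Finset.subset_univ I)] at h3
    · rw [← h3]
      refine Finset.sum_congr rfl fun i _ => ?_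
      rw [hl x hx, hl x₀ hx₀, ← gap_sub_gap (a := k • a)]
      ring
    · intro i _ hi
      rw [(mem_directionSpace_iff htouch).1 hw i hi, zero_mul]
  set Q := ∏ i ∈ I, (√(2 * Real.pi * (k * gap v a i m)) * Real.exp (-(k * gap v a i m))) with hQ
  have hQpos : 0 < Q := Finset.prod_pos fun i hi => by
    have := hkpos i hi
    have := Real.pi_pos
    positivity
  set Z := ∏ i ∈ I, (k * gap v a i m) ^ l x₀ i with hZ
  have hZpos : 0 < Z := Finset.prod_pos fun i hi => pow_pos (hkpos i hi) _
  refine ⟨(∑ i, l x₀ i).factorial / (Q * Z), by positivity, fun x hx => ?_⟩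
  have hw : (∏ i, ((l x i).factorial : ℝ)) * weight v (k • a) x = (∑ i, l x₀ i).factorial := by
    rw [← hN x hx]
    exact_mod_cast Nat.multinomial_spec Finset.univ (l x)
  rw [← Finset.prod_subset (Finset.subset_univ I)] at hw
  · have hP : productWeight v a m k x * (∏ i ∈ I, ((l x i).factorial : ℝ)) = Q * Z := by
      rw [← hprod x hx, hQ, productWeight, ← Finset.prod_mul_distrib,
        ← Finset.prod_mul_distrib]
      refine Finset.prod_congr rfl fun i _ => ?_
      have : ((l x i).factorial : ℝ) ≠ 0 := by exact_mod_cast (l x i).factorial_ne_zero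
      change poissonWeight _ (l x i) * _ = _
      rw [poissonWeight]
      field_simp
    have hF : (∏ i ∈ I, ((l x i).factorial : ℝ)) ≠ 0 :=
      Finset.prod_ne_zero_iff.2 fun i _ => by exact_mod_cast (l x i).factorial_ne_zero
    rw [← hw, ← hP]
    have hPne : productWeight v a m k x ≠ 0 := by
      intro h; rw [h, zero_mul] at hP; exact (mul_pos hQpos hZpos).ne hP
    field_simp
  · intro i _ hi
    simp [hl0 x hx i hi]

/-- Some dilate `N` of the affine span of `P` contains an integral point `z`. For `k = N t`,
rounding the coordinates of `k p - t z` in a lattice basis of `L` changes each form by a bounded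
amount, while the forms nonconstant on `P` take values at `k p` that grow linearly in `t`. -/
lemma infinite_admissible
    (htouch : ∀ i, (hyperplane v a i ∩ polyhedron v a).Nonempty) : (admissible v a).Infinite := by
  obtain ⟨p, hp, hpos⟩ := exists_gap_pos (polyhedron_nonempty htouch)
  obtain ⟨d, B, b, hB, -⟩ := exists_lattice_basis _ (directionSpace_le_span htouch)
  obtain ⟨N, hN, z, hz⟩ := exists_integral_solution_of_dilate
    (fun i : {i // i ∉ nonconstIndices v a} => v i) (fun i => a i) p
    fun i => gap_eq_zero htouch i.2 hp
  have hlim : ∀ᶠ t : ℕ in atTop, ∀ i ∈ nonconstIndices v a,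
      ∑ j, |pairing (v i) (B j)| ≤ (N * t : ℕ) * gap v a i p := by
    refine (Finset.eventually_all _).2 fun i hi => ?_
    have hNt : Tendsto (fun t : ℕ => ((N * t : ℕ) : ℝ)) atTop atTop :=
      tendsto_natCast_atTop_atTop.comp (tendsto_id.const_mul_atTop' hN)
    exact (hNt.atTop_mul_const (hpos i hi)).eventually_ge_atTop _
  refine Set.infinite_of_forall_exists_gt fun M => ?_
  obtain ⟨t, ht, htM⟩ := (hlim.and (eventually_gt_atTop M)).exists
  have hMNt : M < N * t := htM.trans_le (Nat.le_mul_of_pos_left t hN)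
  refine ⟨N * t, ⟨(Nat.zero_le M).trans_lt hMNt, ?_⟩, hMNt⟩
  have hx : ∀ i ∉ nonconstIndices v a, gap v ((N * t) • a) i (toReal ((t : ℤ) • z)) = 0 := by
    intro i hi
    have h1 : v i ⬝ᵥ z + N * a i = 0 := hz ⟨i, hi⟩
    rw [gap_toReal, dotProduct_smul]
    have h2 : (t : ℤ) • (v i ⬝ᵥ z) + ((N * t) • a) i = t * (v i ⬝ᵥ z + N * a i) := by
      simp; ring
    rw [h2, h1]; simp
  have hL := smul_sub_mem_directionSpace htouch hp hx
  let c := B.repr ⟨_, hL⟩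
  have hc : ((N * t : ℕ) : ℝ) • p = toReal ((t : ℤ) • z) + ∑ j, c j • toReal (b j) := by
    have := congrArg (fun y : directionSpace v a => (y : E n)) (B.sum_repr ⟨_, hL⟩)
    simp only [Submodule.coe_sum, Submodule.coe_smul, hB] at this
    rw [this]; abel
  -- Rounding stays in the coset `t z + L`, so the forms constant on `P` remain exactly zero.
  refine ⟨(t : ℤ) • z + ∑ j, ⌊c j⌋ • b j, mem_polyhedron.2 fun i => ?_⟩
  have e : toReal ((t : ℤ) • z + ∑ j, ⌊c j⌋ • b j) =
      ((N * t : ℕ) : ℝ) • p + ∑ j, ((⌊c j⌋ : ℝ) - c j) • (B j : E n) := by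
    rw [hc, toReal_add, toReal_sum_smul]
    simp only [sub_smul, Finset.sum_sub_distrib, hB]
    abel
  rw [e, gap_add, gap_nsmul_smul, pairing_sum]
  simp only [pairing_smul]
  by_cases hi : i ∈ nonconstIndices v a
  · have h1 : |∑ j, ((⌊c j⌋ : ℝ) - c j) * pairing (v i) (B j)| ≤ ∑ j, |pairing (v i) (B j)| := by
      refine (Finset.abs_sum_le_sum_abs _ _).trans (Finset.sum_le_sum fun j _ => ?_)
      rw [abs_mul]
      refine mul_le_of_le_one_left (abs_nonneg _) (abs_le.2 ⟨?_, ?_⟩)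
      · linarith [Int.lt_floor_add_one (c j)]
      · linarith [Int.floor_le (c j)]
    linarith [ht i hi, (abs_le.1 h1).1]
  · rw [gap_eq_zero htouch hi hp, mul_zero, zero_add]
    refine (Finset.sum_eq_zero fun j _ => ?_).ge
    rw [(mem_directionSpace_iff htouch).1 (B j).2 i hi, mul_zero]

end Dilates

/-! ### Lattice sums as integrals over cells. -/

section FloorIntegral

/-- Unit cells have volume one, so the floor map pushes Lebesgue measure to counting measure. -/
lemma lintegral_floor {d : ℕ} (F : (Fin d → ℤ) → ℝ≥0∞) :
    ∫⁻ t : Fin d → ℝ, F (fun j => ⌊t j⌋) = ∑' z, F z := by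
  have hmeas : Measurable fun (t : Fin d → ℝ) (j : Fin d) => ⌊t j⌋ :=
    measurable_pi_lambda _ fun j => Int.measurable_floor.comp (measurable_pi_apply j)
  have hmap : Measure.map (fun (t : Fin d → ℝ) (j : Fin d) => ⌊t j⌋) volume = Measure.count := by
    refine Measure.ext_of_singleton fun z => ?_
    rw [Measure.map_apply hmeas (measurableSet_singleton z), Measure.count_singleton]
    have : (fun (t : Fin d → ℝ) (j : Fin d) => ⌊t j⌋) ⁻¹' {z} =
        Set.univ.pi fun j => Set.Ico (z j : ℝ) (z j + 1) := by
      ext t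
      simp [funext_iff, Int.floor_eq_iff]
    rw [this, volume_pi_pi]
    simp
  rw [← lintegral_count, ← hmap, lintegral_map (measurable_of_countable F) hmeas]

/-- The constant is the cell volume `R ^ (-d)`. Its value is left out because it cancels on
normalization. -/
lemma lintegral_floor_affine {d : ℕ} (τ : Fin d → ℝ) {R : ℝ} (hR : 0 < R) :
    ∃ c : ℝ≥0∞, c ≠ 0 ∧ c ≠ ∞ ∧ ∀ F : (Fin d → ℤ) → ℝ≥0∞,
      ∫⁻ s : Fin d → ℝ, F (fun j => ⌊τ j + R * s j⌋) = c * ∑' z, F z := by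
  refine ⟨ENNReal.ofReal |(R ^ Module.finrank ℝ (Fin d → ℝ))⁻¹|, ?_, ENNReal.ofReal_ne_top,
    fun F => ?_⟩
  · rw [Ne, ENNReal.ofReal_eq_zero, not_le]; positivity
  have hmeas : Measurable fun (t : Fin d → ℝ) (j : Fin d) => ⌊t j⌋ :=
    measurable_pi_lambda _ fun j => Int.measurable_floor.comp (measurable_pi_apply j)
  have hF : Measurable fun t : Fin d → ℝ => F (fun j => ⌊(τ + t) j⌋) :=
    (measurable_of_countable F).comp (hmeas.comp (measurable_const_add τ))
  have h1 := lintegral_map (μ := volume) hF (measurable_const_smul R)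
  rw [Measure.map_addHaar_smul volume hR.ne', lintegral_smul_measure,
    lintegral_add_left_eq_self (fun t : Fin d → ℝ => F fun j => ⌊t j⌋) τ, lintegral_floor] at h1
  exact h1.symm

end FloorIntegral

/-! ### The law as a normalized cell integral. -/

section Law

variable {n r d : ℕ} {v : Fin r → Fin n → ℤ} {a : Fin r → ℤ}

lemma weight_pos (x : Fin n → ℤ) : 0 < weight v a x := Nat.multinomial_pos _ _

lemma totalWeight_ne_zero (hne : (latticePoints v a).Nonempty) : totalWeight v a ≠ 0 := by
  obtain ⟨x, hx⟩ := hne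
  refine fun h => ?_
  have := ENNReal.tsum_eq_zero.1 h ⟨x, hx⟩
  exact (weight_pos (v := v) (a := a) x).ne' (by exact_mod_cast this)

lemma totalWeight_ne_top (hfin : (latticePoints v a).Finite) : totalWeight v a ≠ ∞ := by
  have := hfin.to_subtype
  have := Fintype.ofFinite (latticePoints v a)
  rw [totalWeight, tsum_fintype]
  exact ENNReal.sum_ne_top.2 fun x _ => ENNReal.natCast_ne_top _

lemma lintegral_law {g : E n → ℝ≥0∞} (hg : Measurable g) :
    ∫⁻ x, g x ∂(law v a) =
      (totalWeight v a)⁻¹ * ∑' x : latticePoints v a, (weight v a x : ℝ≥0∞) * g (toReal x) := by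
  rw [law, lintegral_smul_measure, lintegral_sum_measure, smul_eq_mul]
  simp only [lintegral_smul_measure, lintegral_dirac' _ hg, smul_eq_mul]

lemma isProbabilityMeasure_law (hne : (latticePoints v a).Nonempty)
    (hfin : (latticePoints v a).Finite) : IsProbabilityMeasure (law v a) := by
  constructor
  rw [← lintegral_one, lintegral_law measurable_const]
  simp only [mul_one]
  exact ENNReal.inv_mul_cancel (totalWeight_ne_zero hne) (totalWeight_ne_top hfin)

/-- The affine parametrization of a coset of the lattice generated by `b`. -/
def latticeMap (x₀ : Fin n → ℤ) (b : Fin d → Fin n → ℤ) (z : Fin d → ℤ) : Fin n → ℤ :=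
  x₀ + ∑ j, z j • b j

/-- The index of the cell of side `1 / R` containing `s`. -/
def cellIndex (τ : Fin d → ℝ) (R : ℝ) (s : Fin d → ℝ) : Fin d → ℤ := fun j => ⌊τ j + R * s j⌋

lemma measurable_cellIndex (τ : Fin d → ℝ) (R : ℝ) : Measurable (cellIndex τ R) :=
  measurable_pi_lambda _ fun j => Int.measurable_floor.comp (by fun_prop)

/-- The product weight, restricted to the lattice points of `k P`. -/
def cellDensity (v : Fin r → Fin n → ℤ) (a : Fin r → ℤ) (m : E n) (k : ℕ) (x : Fin n → ℤ) : ℝ :=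
  (latticePoints v (k • a)).indicator (productWeight v a m k) x

lemma productWeight_nonneg {m : E n} (hm : m ∈ polyhedron v a) (k : ℕ) (x : Fin n → ℤ) :
    0 ≤ productWeight v a m k x :=
  Finset.prod_nonneg fun i _ =>
    poissonWeight_nonneg (mul_nonneg (Nat.cast_nonneg k) (mem_polyhedron.1 hm i)) _

lemma cellDensity_nonneg {m : E n} (hm : m ∈ polyhedron v a) (k : ℕ) (x : Fin n → ℤ) :
    0 ≤ cellDensity v a m k x :=
  Set.indicator_nonneg (fun _ _ => productWeight_nonneg hm k _) _

lemma cellDensity_of_mem {m : E n} {k : ℕ} {x : Fin n → ℤ} (hx : x ∈ latticePoints v (k • a)) :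
    cellDensity v a m k x = productWeight v a m k x := Set.indicator_of_mem hx _

lemma cellDensity_of_notMem {m : E n} {k : ℕ} {x : Fin n → ℤ} (hx : x ∉ latticePoints v (k • a)) :
    cellDensity v a m k x = 0 := Set.indicator_of_notMem hx _

/-- All constants (total weight, Poisson proportionality, cell volume) are collected in an
unspecified `c`, to be recovered from total mass one. -/
lemma map_law_eq {m : E n} {k : ℕ} {C : ℝ} (hC : 0 ≤ C)
    (hw : ∀ x ∈ latticePoints v (k • a), (weight v (k • a) x : ℝ) = C * productWeight v a m k x)
    {φ : (Fin d → ℤ) → Fin n → ℤ} (hφ : Function.Injective φ)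
    (hrange : latticePoints v (k • a) ⊆ Set.range φ) (τ : Fin d → ℝ) {R : ℝ} (hR : 0 < R)
    {T : E n → E n} (hT : Measurable T) :
    ∃ c : ℝ≥0∞, (law v (k • a)).map T =
      c • (volume.withDensity fun s =>
        ENNReal.ofReal (cellDensity v a m k (φ (cellIndex τ R s)))).map
          fun s => T (toReal (φ (cellIndex τ R s))) := by
  obtain ⟨c, hc0, hctop, hc⟩ := lintegral_floor_affine τ hR
  refine ⟨(totalWeight v (k • a))⁻¹ * ENNReal.ofReal C * c⁻¹, ?_⟩
  have hy : Measurable fun s => T (toReal (φ (cellIndex τ R s))) :=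
    (measurable_of_countable fun z => T (toReal (φ z))).comp (measurable_cellIndex τ R)
  have hD : Measurable fun s => ENNReal.ofReal (cellDensity v a m k (φ (cellIndex τ R s))) :=
    (measurable_of_countable fun z => ENNReal.ofReal (cellDensity v a m k (φ z))).comp
      (measurable_cellIndex τ R)
  refine Measure.ext_of_lintegral _ fun g hg => ?_
  have h0 := lintegral_law (v := v) (a := k • a) (hg.comp hT)
  simp only [Function.comp_def] at h0
  rw [lintegral_map hg hT, h0, lintegral_smul_measure,
    lintegral_map hg hy]
  have h1 := (lintegral_withDensity_eq_lintegral_mul volume hD (hg.comp hy)).trans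
    (hc fun z => ENNReal.ofReal (cellDensity v a m k (φ z)) * g (T (toReal (φ z))))
  simp only [Function.comp_def] at h1
  rw [h1, smul_eq_mul, mul_assoc, ENNReal.inv_mul_cancel_left hc0 hctop, mul_assoc]
  congr 1
  have hsupp : Function.support (fun x => ENNReal.ofReal (cellDensity v a m k x) *
      g (T (toReal x))) ⊆ Set.range φ := by
    intro x hx
    refine hrange ?_
    by_contra h
    exact hx (by simp only [cellDensity_of_notMem h, ENNReal.ofReal_zero, zero_mul])
  have h2 := hφ.tsum_eq hsupp
  rw [h2, ← ENNReal.tsum_mul_left,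
    ← tsum_subtype_eq_of_support_subset (s := latticePoints v (k • a))]
  · refine tsum_congr fun x => ?_
    rw [cellDensity_of_mem x.2, ← mul_assoc, ← ENNReal.ofReal_mul hC, ← hw x x.2,
      ENNReal.ofReal_natCast]
  · intro x hx
    by_contra h
    exact hx (by simp only [cellDensity_of_notMem h, ENNReal.ofReal_zero, zero_mul, mul_zero])

lemma integral_map_law_eq {m : E n} (hm : m ∈ polyhedron v a) {k : ℕ} {C : ℝ} (hC : 0 ≤ C)
    (hw : ∀ x ∈ latticePoints v (k • a), (weight v (k • a) x : ℝ) = C * productWeight v a m k x)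
    {φ : (Fin d → ℤ) → Fin n → ℤ} (hφ : Function.Injective φ)
    (hrange : latticePoints v (k • a) ⊆ Set.range φ) (τ : Fin d → ℝ) {R : ℝ} (hR : 0 < R)
    {T : E n → E n} (hT : Measurable T) [IsProbabilityMeasure (law v (k • a))]
    {F : Type} [NormedAddCommGroup F] [NormedSpace ℝ F] {G : E n → F}
    (hG : StronglyMeasurable G) :
    ∫ x, G (T x) ∂(law v (k • a)) =
      (∫ s, cellDensity v a m k (φ (cellIndex τ R s)))⁻¹ •
        ∫ s, cellDensity v a m k (φ (cellIndex τ R s)) •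
          G (T (toReal (φ (cellIndex τ R s)))) := by
  obtain ⟨c, hc⟩ := map_law_eq hC hw hφ hrange τ hR hT
  have hy : Measurable fun s => T (toReal (φ (cellIndex τ R s))) :=
    (measurable_of_countable fun z => T (toReal (φ z))).comp (measurable_cellIndex τ R)
  have hD : Measurable fun s => ENNReal.ofReal (cellDensity v a m k (φ (cellIndex τ R s))) :=
    (measurable_of_countable fun z => ENNReal.ofReal (cellDensity v a m k (φ z))).comp
      (measurable_cellIndex τ R)
  have key : ∀ {F : Type} [NormedAddCommGroup F] [NormedSpace ℝ F] {G : E n → F},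
      StronglyMeasurable G → ∫ x, G (T x) ∂(law v (k • a)) =
        c.toReal • ∫ s, cellDensity v a m k (φ (cellIndex τ R s)) •
          G (T (toReal (φ (cellIndex τ R s)))) := by
    intro F _ _ G hG
    rw [← integral_map hT.aemeasurable hG.aestronglyMeasurable, hc, integral_smul_measure,
      integral_map hy.aemeasurable hG.aestronglyMeasurable,
      integral_withDensity_eq_integral_toReal_smul hD (Eventually.of_forall fun _ =>
        ENNReal.ofReal_lt_top)]
    simp only [ENNReal.toReal_ofReal (cellDensity_nonneg hm _ _)]
  -- The test function `1` determines `c`.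
  have h1 : (1 : ℝ) = c.toReal * ∫ s, cellDensity v a m k (φ (cellIndex τ R s)) := by
    have := key (G := fun _ => (1 : ℝ)) stronglyMeasurable_const
    simpa using this
  rw [key hG, ← eq_inv_of_mul_eq_one_left h1.symm]

end Law

/-! ### Limit and domination of the cell densities. -/

section Limit

variable {n r d : ℕ} {v : Fin r → Fin n → ℤ} {a : Fin r → ℤ}

lemma gap_of_toReal_eq {m y : E n} {k : ℕ} {x : Fin n → ℤ}
    (hx : toReal x = (k : ℝ) • m + √k • y) (i : Fin r) :
    gap v (k • a) i (toReal x) = k * gap v a i m + √k * pairing (v i) y := by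
  rw [hx, gap_add, gap_nsmul_smul, pairing_smul]

/-- The forms are nonnegative on `k P` with sum `k ∑ a_j`, so each is at most a fixed multiple of
its Poisson mean and the Gaussian bound applies. Since `l_i - k g_i = √k ⟨v_i, y⟩`, the exponent is
free of `k`. -/
lemma exists_cellDensity_le (hsum : ∑ i, v i = 0) {m : E n}
    (hpos : ∀ i ∈ nonconstIndices v a, 0 < gap v a i m) :
    ∃ (C : ℝ) (c : Fin r → ℝ), 0 < C ∧ (∀ i, 0 < c i) ∧
      ∀ (k : ℕ) (x : Fin n → ℤ) (y : E n), 0 < k → toReal x = (k : ℝ) • m + √k • y →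
        cellDensity v a m k x ≤
          C * Real.exp (-∑ i ∈ nonconstIndices v a, c i / gap v a i m * pairing (v i) y ^ 2) := by
  choose C c hC hc hbound using fun i : Fin r =>
    exists_poissonWeight_le_exp ((∑ j, (a j : ℝ)) / gap v a i m)
  refine ⟨∏ i ∈ nonconstIndices v a, C i, c, Finset.prod_pos fun i _ => hC i, hc,
    fun k x y hk hxy => ?_⟩
  have hk' : (0 : ℝ) < k := by exact_mod_cast hk
  by_cases hx : x ∈ latticePoints v (k • a)
  · rw [cellDensity_of_mem hx, productWeight, ← Finset.sum_neg_distrib, Real.exp_sum,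
      ← Finset.prod_mul_distrib]
    refine Finset.prod_le_prod (fun i hi => poissonWeight_nonneg
      (mul_nonneg hk'.le (hpos i hi).le) _) fun i hi => ?_
    have hl := natCast_toNat_eq_gap hx i
    have hle : gap v (k • a) i (toReal x) ≤ k * ∑ j, (a j : ℝ) := by
      have h1 := Finset.single_le_sum (f := fun j => gap v (k • a) j (toReal x))
        (fun j _ => mem_polyhedron.1 hx j) (Finset.mem_univ i)
      rw [sum_gap hsum] at h1
      simpa [Finset.mul_sum] using h1
    refine (hbound i _ (mul_pos hk' (hpos i hi)) _ ?_).trans (le_of_eq ?_)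
    · rw [hl]
      refine hle.trans (le_of_eq ?_)
      have := (hpos i hi).ne'
      field_simp
    · rw [hl, gap_of_toReal_eq hxy, add_sub_cancel_left, mul_pow, Real.sq_sqrt hk'.le]
      congr 2
      have := (hpos i hi).ne'
      field_simp
  · rw [cellDensity_of_notMem hx]
    have : 0 < ∏ i ∈ nonconstIndices v a, C i := Finset.prod_pos fun i _ => hC i
    positivity

/-- The fluctuation `√k ⟨v_i, y⟩` is eventually dominated by `k g_i`, so the points enter `k P`;
then the local limit theorem applies to each factor. -/
lemma tendsto_cellDensity (htouch : ∀ i, (hyperplane v a i ∩ polyhedron v a).Nonempty) {m : E n}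
    (hm : m ∈ polyhedron v a) (hpos : ∀ i ∈ nonconstIndices v a, 0 < gap v a i m)
    {ι : Type*} {F : Filter ι} {k : ι → ℕ} (hk : Tendsto k F atTop) {x : ι → Fin n → ℤ}
    {y : ι → E n} {y₀ : E n} (hxy : ∀ᶠ j in F, toReal (x j) = (k j : ℝ) • m + √(k j) • y j)
    (hyL : ∀ j, y j ∈ directionSpace v a) (hy : Tendsto y F (𝓝 y₀)) :
    Tendsto (fun j => cellDensity v a m (k j) (x j)) F
      (𝓝 (Real.exp (-(1 / 2) * quadForm v a m y₀))) := by
  have hkR : Tendsto (fun j => (k j : ℝ)) F atTop := tendsto_natCast_atTop_atTop.comp hk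
  have hk0 : ∀ᶠ j in F, (0 : ℝ) < k j := hkR.eventually_gt_atTop 0
  have hpy : ∀ i, Tendsto (fun j => pairing (v i) (y j)) F (𝓝 (pairing (v i) y₀)) :=
    fun i => ((continuous_pairing (v i)).tendsto y₀).comp hy
  have hmem : ∀ᶠ j in F, x j ∈ latticePoints v (k j • a) := by
    have : ∀ i, ∀ᶠ j in F, 0 ≤ gap v (k j • a) i (toReal (x j)) := fun i => by
      by_cases hi : i ∈ nonconstIndices v a
      · have hsq : Tendsto (fun j => √(k j : ℝ) * gap v a i m) F atTop :=
          (Real.tendsto_sqrt_atTop.comp hkR).atTop_mul_const (hpos i hi)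
        have h1 := hsq.atTop_add (hpy i)
        filter_upwards [hxy, h1.eventually_ge_atTop 0, hk0] with j hj hj1 hj0
        rw [gap_of_toReal_eq hj]
        have h2 : (k j : ℝ) * gap v a i m = √(k j) * (√(k j) * gap v a i m) := by
          rw [← mul_assoc, Real.mul_self_sqrt hj0.le]
        rw [h2, ← mul_add]
        exact mul_nonneg (Real.sqrt_nonneg _) hj1
      · filter_upwards [hxy] with j hj
        rw [gap_of_toReal_eq hj, gap_eq_zero htouch hi hm,
          (mem_directionSpace_iff htouch).1 (hyL j) i hi]
        simp
    filter_upwards [eventually_all.2 this] with j hj using mem_polyhedron.2 hj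
  have hprod : Tendsto (fun j => productWeight v a m (k j) (x j)) F
      (𝓝 (∏ i ∈ nonconstIndices v a,
        Real.exp (-(1 / 2) * (pairing (v i) y₀ / √(gap v a i m)) ^ 2))) := by
    refine tendsto_finsetProd _ fun i hi => ?_
    refine tendsto_poissonWeight (hkR.atTop_mul_const (hpos i hi)) ?_
    refine ((hpy i).div_const _).congr' ?_
    filter_upwards [hxy, hmem, hk0] with j hj hjm hj0
    rw [natCast_toNat_eq_gap hjm, gap_of_toReal_eq hj, add_sub_cancel_left,
      Real.sqrt_mul hj0.le, mul_div_mul_left _ _ (Real.sqrt_pos.2 hj0).ne']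
  have hlim : ∏ i ∈ nonconstIndices v a,
      Real.exp (-(1 / 2) * (pairing (v i) y₀ / √(gap v a i m)) ^ 2) =
      Real.exp (-(1 / 2) * quadForm v a m y₀) := by
    rw [← Real.exp_sum, ← Finset.mul_sum, quadForm]
    congr 2
    refine Finset.sum_congr rfl fun i hi => ?_
    rw [div_pow, Real.sq_sqrt (hpos i hi).le]
    rfl
  rw [← hlim]
  refine hprod.congr' ?_
  filter_upwards [hmem] with j hj using (cellDensity_of_mem hj).symm

/-- The linear parametrization with the basis `b`. -/
def latticeParam (b : Fin d → Fin n → ℤ) : (Fin d → ℝ) →L[ℝ] E n :=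
  ∑ j, (ContinuousLinearMap.proj (R := ℝ) (φ := fun _ : Fin d => ℝ) j).smulRight (toReal (b j))

lemma latticeParam_apply (b : Fin d → Fin n → ℤ) (s : Fin d → ℝ) :
    latticeParam b s = ∑ j, s j • toReal (b j) := by
  simp [latticeParam]

/-- The rescaled position of the lattice point of the cell containing `s`. -/
def cellOffset (τ : Fin d → ℝ) (R : ℝ) (s : Fin d → ℝ) : Fin d → ℝ :=
  fun j => R⁻¹ * (cellIndex τ R s j - τ j)

lemma norm_cellOffset_sub_le (τ : Fin d → ℝ) {R : ℝ} (hR : 0 < R) (s : Fin d → ℝ) :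
    ‖cellOffset τ R s - s‖ ≤ R⁻¹ := by
  refine (pi_norm_le_iff_of_nonneg (inv_pos.2 hR).le).2 fun j => ?_
  have e : (cellOffset τ R s - s) j = R⁻¹ * (⌊τ j + R * s j⌋ - (τ j + R * s j)) := by
    simp only [cellOffset, cellIndex, Pi.sub_apply]
    field_simp
    ring
  rw [e, norm_mul, Real.norm_of_nonneg (inv_pos.2 hR).le]
  refine mul_le_of_le_one_right (inv_pos.2 hR).le (abs_le.2 ⟨?_, ?_⟩)
  · linarith [Int.lt_floor_add_one (τ j + R * s j)]
  · linarith [Int.floor_le (τ j + R * s j)]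

lemma toReal_latticeMap_cellIndex {x₀ : Fin n → ℤ} {b : Fin d → Fin n → ℤ} {τ : Fin d → ℝ}
    {p : E n} (hτ : p = toReal x₀ + latticeParam b τ) {R : ℝ} (hR : 0 < R) (s : Fin d → ℝ) :
    toReal (latticeMap x₀ b (cellIndex τ R s)) =
      p + R • latticeParam b (cellOffset τ R s) := by
  have h1 : R • cellOffset τ R s = (fun j => (cellIndex τ R s j : ℝ)) - τ := by
    ext j
    simp only [cellOffset, Pi.smul_apply, smul_eq_mul, Pi.sub_apply]
    rw [mul_inv_cancel_left₀ hR.ne']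
  rw [← map_smul, h1, map_sub, hτ, latticeMap, toReal_add, toReal_sum_smul,
    latticeParam_apply b (fun j => (cellIndex τ R s j : ℝ))]
  abel

lemma tendsto_cellOffset {ι : Type*} {F : Filter ι} (τ : ι → Fin d → ℝ) {R : ι → ℝ}
    (hR : Tendsto R F atTop) (s : Fin d → ℝ) :
    Tendsto (fun i => cellOffset (τ i) (R i) s) F (𝓝 s) := by
  rw [tendsto_iff_norm_sub_tendsto_zero]
  refine squeeze_zero' (Eventually.of_forall fun _ => norm_nonneg _) ?_
    (tendsto_inv_atTop_zero.comp hR)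
  filter_upwards [hR.eventually_gt_atTop 0] with i hi using norm_cellOffset_sub_le _ hi s

/-- A positive definite sum of squares dominates the square of the norm. -/
lemma exists_mul_norm_sq_le {V ι : Type*} [NormedAddCommGroup V] [NormedSpace ℝ V]
    [FiniteDimensional ℝ V] (I : Finset ι) (ℓ : ι → V →ₗ[ℝ] ℝ) (c : ι → ℝ) (hc : ∀ i ∈ I, 0 < c i)
    (hℓ : ∀ u, (∀ i ∈ I, ℓ i u = 0) → u = 0) :
    ∃ δ : ℝ, 0 < δ ∧ ∀ u, δ * ‖u‖ ^ 2 ≤ ∑ i ∈ I, c i * ℓ i u ^ 2 := by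
  -- An injective linear map on a finite-dimensional space is bounded below, and the sup norm of `S
  -- u` is at most the square root of the sum.
  let S : V →ₗ[ℝ] (I → ℝ) := LinearMap.pi fun i => √(c i) • ℓ i
  have hS : LinearMap.ker S = ⊥ := by
    rw [LinearMap.ker_eq_bot']
    intro u hu
    refine hℓ u fun i hi => ?_
    have := congrFun hu ⟨i, hi⟩
    have h2 : √(c i) * ℓ i u = 0 := this
    exact (mul_eq_zero.1 h2).resolve_left (Real.sqrt_pos.2 (hc i hi)).ne'
  obtain ⟨K, hK0, hK⟩ := S.exists_antilipschitzWith hS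
  refine ⟨((K : ℝ) ^ 2)⁻¹, by positivity, fun u => ?_⟩
  have h1 : ‖u‖ ≤ K * ‖S u‖ := by simpa using hK.le_mul_dist u 0
  have h0 : 0 ≤ ∑ i ∈ I, c i * ℓ i u ^ 2 :=
    Finset.sum_nonneg fun i hi => mul_nonneg (hc i hi).le (sq_nonneg _)
  have h2 : ‖S u‖ ≤ √(∑ i ∈ I, c i * ℓ i u ^ 2) := by
    refine (pi_norm_le_iff_of_nonneg (Real.sqrt_nonneg _)).2 fun i => Real.abs_le_sqrt ?_
    have h3 : S u i ^ 2 = c i * ℓ i u ^ 2 := by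
      change (√(c i) * ℓ i u) ^ 2 = _
      rw [mul_pow, Real.sq_sqrt (hc i i.2).le]
    rw [h3]
    exact Finset.single_le_sum (f := fun i => c i * ℓ i u ^ 2)
      (fun j hj => mul_nonneg (hc j hj).le (sq_nonneg _)) i.2
  have hK' : (0 : ℝ) < K := by exact_mod_cast hK0
  rw [inv_mul_le_iff₀ (by positivity)]
  calc ‖u‖ ^ 2 ≤ (K * √(∑ i ∈ I, c i * ℓ i u ^ 2)) ^ 2 := by
        gcongr
        exact h1.trans (by gcongr)
    _ = _ := by rw [mul_pow, Real.sq_sqrt h0]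

lemma integrable_exp_neg_mul_norm_sq {c : ℝ} (hc : 0 < c) :
    Integrable fun s : Fin d → ℝ => Real.exp (-c * ‖s‖ ^ 2) := by
  -- The norm is the sup norm, so `∑ s_j ^ 2 ≤ d ‖s‖ ^ 2`; dividing by `d + 1` instead of `d` covers
  -- `d = 0`.
  have hd : (0 : ℝ) < d + 1 := by positivity
  have h := Integrable.fintype_prod (fun _ : Fin d => integrable_exp_neg_mul_sq (div_pos hc hd))
  refine h.mono' (by fun_prop) (Eventually.of_forall fun s => ?_)
  rw [Real.norm_of_nonneg (Real.exp_pos _).le, ← Real.exp_sum, Real.exp_le_exp, ← Finset.mul_sum]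
  have h1 : ∑ j, s j ^ 2 ≤ d * ‖s‖ ^ 2 := by
    refine (Finset.sum_le_card_nsmul _ _ (‖s‖ ^ 2) fun j _ => ?_).trans (by simp)
    rw [← sq_abs]
    exact pow_le_pow_left₀ (abs_nonneg _) (norm_le_pi_norm s j) 2
  have h2 : c / (d + 1) * ∑ j, s j ^ 2 ≤ c * ‖s‖ ^ 2 := by
    rw [div_mul_eq_mul_div, div_le_iff₀ hd]
    nlinarith [mul_le_mul_of_nonneg_left h1 hc.le, mul_nonneg hc.le (sq_nonneg ‖s‖)]
  linarith

/-- Absorbs the linear growth of test functions into the Gaussian, as is needed for the convergence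
of the mean. -/
lemma one_add_mul_exp_le {δ x : ℝ} (hδ : 0 < δ) :
    (1 + x) * Real.exp (-(δ * x ^ 2)) ≤ (1 + 1 / (2 * δ)) * Real.exp (-(δ / 2 * x ^ 2)) := by
  have h1 : x ≤ 1 / (2 * δ) + δ / 2 * x ^ 2 := by
    have : 1 / (2 * δ) + δ / 2 * x ^ 2 - x = (δ * x - 1) ^ 2 / (2 * δ) := by field_simp; ring
    have h2 : 0 ≤ (δ * x - 1) ^ 2 / (2 * δ) := by positivity
    linarith
  have h2 : 1 + x ≤ (1 + 1 / (2 * δ)) * Real.exp (δ / 2 * x ^ 2) := by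
    have h3 := Real.add_one_le_exp (δ / 2 * x ^ 2)
    have h4 : 0 < 1 / (2 * δ) := by positivity
    have h5 : 0 ≤ δ / 2 * x ^ 2 := by positivity
    nlinarith
  have h3 : Real.exp (-(δ / 2 * x ^ 2)) =
      Real.exp (δ / 2 * x ^ 2) * Real.exp (-(δ * x ^ 2)) := by
    rw [← Real.exp_add]; ring_nf
  rw [h3, ← mul_assoc]
  gcongr

/-- Dominated convergence for the Riemann sums. -/
lemma tendsto_integral_cellDensity (hsum : ∑ i, v i = 0)
    (htouch : ∀ i, (hyperplane v a i ∩ polyhedron v a).Nonempty) {m : E n}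
    (hm : m ∈ polyhedron v a) (hpos : ∀ i ∈ nonconstIndices v a, 0 < gap v a i m)
    {b : Fin d → Fin n → ℤ} (hbL : ∀ s, latticeParam b s ∈ directionSpace v a)
    (hb : ∀ u, (∀ i ∈ nonconstIndices v a, pairing (v i) (latticeParam b u) = 0) → u = 0)
    {ι : Type*} {F : Filter ι} [F.IsCountablyGenerated] {k : ι → ℕ} (hk : Tendsto k F atTop)
    {x₀ : ι → Fin n → ℤ} {τ : ι → Fin d → ℝ}
    (hτ : ∀ j, (k j : ℝ) • m = toReal (x₀ j) + latticeParam b (τ j))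
    {X : Type*} [NormedAddCommGroup X] [NormedSpace ℝ X] {G : ι → E n → X} {G₀ : E n → X} {M : ℝ}
    (hGm : ∀ j, StronglyMeasurable (G j)) (hGM : ∀ j y, ‖G j y‖ ≤ M * (1 + ‖y‖))
    (hG : ∀ (y : ι → E n) (y₀ : E n), Tendsto y F (𝓝 y₀) →
      Tendsto (fun j => G j (y j)) F (𝓝 (G₀ y₀))) :
    Tendsto (fun j => ∫ s, cellDensity v a m (k j) (latticeMap (x₀ j) b
        (cellIndex (τ j) √(k j) s)) • G j (latticeParam b (cellOffset (τ j) √(k j) s))) F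
      (𝓝 (∫ s, Real.exp (-(1 / 2) * quadForm v a m (latticeParam b s)) •
        G₀ (latticeParam b s))) := by
  rcases F.eq_or_neBot with rfl | hF
  · exact tendsto_bot
  have hk0 : ∀ᶠ j in F, 0 < k j := hk.eventually_gt_atTop 0
  have hsq : Tendsto (fun j => √(k j : ℝ)) F atTop :=
    Real.tendsto_sqrt_atTop.comp (tendsto_natCast_atTop_atTop.comp hk)
  have hsq0 : ∀ j, 0 < k j → 0 < √(k j : ℝ) := fun j hj =>
    Real.sqrt_pos.2 (by exact_mod_cast hj)
  obtain ⟨C, c, hC, hc, hbound⟩ := exists_cellDensity_le hsum hpos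
  obtain ⟨δ, hδ, hδb⟩ := exists_mul_norm_sq_le (nonconstIndices v a)
    (fun i => ((pairingL (v i)).comp (latticeParam b)).toLinearMap)
    (fun i => c i / gap v a i m) (fun i hi => div_pos (hc i) (hpos i hi)) (fun u hu => hb u
      fun i hi => by simpa [pairingL_apply] using hu i hi)
  have hδb' : ∀ u, δ * ‖u‖ ^ 2 ≤ ∑ i ∈ nonconstIndices v a,
      c i / gap v a i m * pairing (v i) (latticeParam b u) ^ 2 := fun u => by
    simpa [pairingL_apply] using hδb u
  have hM : 0 ≤ M := by
    obtain ⟨j, -⟩ := hk0.exists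
    have := (norm_nonneg _).trans (hGM j 0)
    simpa using this
  set N := ‖latticeParam b‖ with hN
  have hN0 : 0 ≤ N := norm_nonneg _
  -- The bound is Gaussian in the offset `u` of the cell containing `s`. As `‖s - u‖ ≤ 1`, one has
  -- `‖s‖ ^ 2 ≤ 2 ‖u‖ ^ 2 + 2`, which trades `δ / 2` for `δ / 4` and the factor `exp (δ / 2)`.
  refine tendsto_integral_filter_of_dominated_convergence
    (fun s => C * (M * ((1 + N) * ((1 + 1 / (2 * δ)) *
      (Real.exp (δ / 2) * Real.exp (-(δ / 4) * ‖s‖ ^ 2)))))) ?_ ?_ ?_ ?_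
  · refine Eventually.of_forall fun j => ?_
    have hD : Measurable fun s => cellDensity v a m (k j)
        (latticeMap (x₀ j) b (cellIndex (τ j) √(k j) s)) :=
      (measurable_of_countable fun z => cellDensity v a m (k j) (latticeMap (x₀ j) b z)).comp
        (measurable_cellIndex (τ j) √(k j))
    have hu : Measurable (cellOffset (τ j) √(k j)) :=
      measurable_pi_lambda _ fun i => (((measurable_of_countable fun z : ℤ => (z : ℝ)).comp
        ((measurable_pi_apply i).comp (measurable_cellIndex (τ j) √(k j)))).sub_const _).const_mul _
    exact (hD.stronglyMeasurable.smul ((hGm j).comp_measurable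
      ((latticeParam b).continuous.measurable.comp hu))).aestronglyMeasurable
  · filter_upwards [hk0] with j hj
    refine Eventually.of_forall fun s => ?_
    set u := cellOffset (τ j) √(k j) s with hu
    have h1 := hbound (k j) _ _ hj (toReal_latticeMap_cellIndex (hτ j) (hsq0 j hj) s)
    have h2 : cellDensity v a m (k j) (latticeMap (x₀ j) b (cellIndex (τ j) √(k j) s)) ≤
        C * Real.exp (-(δ * ‖u‖ ^ 2)) := by
      refine h1.trans ?_
      gcongr
      exact hδb' u
    have h3 : ‖G j (latticeParam b u)‖ ≤ M * ((1 + N) * (1 + ‖u‖)) := by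
      refine (hGM j _).trans ?_
      gcongr
      have := (latticeParam b).le_opNorm u
      nlinarith [norm_nonneg u]
    have h4 : ‖s‖ ≤ ‖u‖ + 1 := by
      have h5 := norm_cellOffset_sub_le (τ j) (hsq0 j hj) s
      have h6 : (√(k j : ℝ))⁻¹ ≤ 1 := by
        refine inv_le_one_of_one_le₀ ?_
        rw [Real.one_le_sqrt]
        exact_mod_cast hj
      have h7 := norm_sub_norm_le s u
      rw [norm_sub_rev] at h7
      linarith
    have h5 : Real.exp (-(δ / 2 * ‖u‖ ^ 2)) ≤
        Real.exp (δ / 2) * Real.exp (-(δ / 4) * ‖s‖ ^ 2) := by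
      rw [← Real.exp_add, Real.exp_le_exp]
      have h6 : ‖s‖ ^ 2 ≤ 2 * ‖u‖ ^ 2 + 2 := by
        nlinarith [norm_nonneg s, norm_nonneg u, sq_nonneg (‖u‖ - 1)]
      nlinarith
    rw [norm_smul, Real.norm_of_nonneg (cellDensity_nonneg hm _ _)]
    calc _ ≤ (C * Real.exp (-(δ * ‖u‖ ^ 2))) * (M * ((1 + N) * (1 + ‖u‖))) :=
          mul_le_mul h2 h3 (norm_nonneg _) (by positivity)
      _ = C * (M * ((1 + N) * ((1 + ‖u‖) * Real.exp (-(δ * ‖u‖ ^ 2))))) := by ring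
      _ ≤ C * (M * ((1 + N) * ((1 + 1 / (2 * δ)) * Real.exp (-(δ / 2 * ‖u‖ ^ 2))))) := by
          gcongr C * (M * ((1 + N) * ?_))
          exact one_add_mul_exp_le hδ
      _ ≤ _ := by gcongr
  · exact ((((((integrable_exp_neg_mul_norm_sq (by positivity)).const_mul _).const_mul
      _).const_mul _).const_mul _).const_mul _)
  · refine Eventually.of_forall fun s => ?_
    have hy : Tendsto (fun j => latticeParam b (cellOffset (τ j) √(k j) s)) F
        (𝓝 (latticeParam b s)) :=
      ((latticeParam b).continuous.tendsto s).comp (tendsto_cellOffset τ hsq s)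
    refine (tendsto_cellDensity htouch hm hpos hk ?_ (fun j => hbL _) hy).smul (hG _ _ hy)
    filter_upwards [hk0] with j hj
    exact toReal_latticeMap_cellIndex (hτ j) (hsq0 j hj) s

end Limit

/-! ### The limiting Gaussian in lattice coordinates. -/

section Gaussian

variable {n r d : ℕ} {v : Fin r → Fin n → ℤ} {a : Fin r → ℤ}

lemma continuous_quadForm (m : E n) : Continuous (quadForm v a m) :=
  continuous_finsetSum _ fun i _ => ((continuous_pairing (v i)).pow 2).div_const _

lemma integrable_exp_neg_quadForm {m : E n} (hpos : ∀ i ∈ nonconstIndices v a, 0 < gap v a i m)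
    {b : Fin d → Fin n → ℤ}
    (hb : ∀ u, (∀ i ∈ nonconstIndices v a, pairing (v i) (latticeParam b u) = 0) → u = 0) :
    Integrable fun s => Real.exp (-(1 / 2) * quadForm v a m (latticeParam b s)) := by
  obtain ⟨δ, hδ, hδb⟩ := exists_mul_norm_sq_le (nonconstIndices v a)
    (fun i => ((pairingL (v i)).comp (latticeParam b)).toLinearMap)
    (fun i => 1 / gap v a i m) (fun i hi => div_pos one_pos (hpos i hi)) (fun u hu => hb u
      fun i hi => by simpa [pairingL_apply] using hu i hi)
  have hcont : Continuous fun s => Real.exp (-(1 / 2) * quadForm v a m (latticeParam b s)) :=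
    Real.continuous_exp.comp
      (((continuous_quadForm m).comp (latticeParam b).continuous).const_mul _)
  refine (integrable_exp_neg_mul_norm_sq (half_pos hδ)).mono' hcont.aestronglyMeasurable
    (Eventually.of_forall fun s => ?_)
  rw [Real.norm_of_nonneg (Real.exp_pos _).le, Real.exp_le_exp]
  have h : δ * ‖s‖ ^ 2 ≤ quadForm v a m (latticeParam b s) := by
    refine (hδb s).trans (le_of_eq (Finset.sum_congr rfl fun i _ => ?_))
    change 1 / gap v a i m * pairingL (v i) (latticeParam b s) ^ 2 = _
    rw [pairingL_apply, one_div_mul_eq_div]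
    rfl
  linarith

variable {L : Submodule ℝ (E n)} {q : E n → ℝ}

lemma exists_subspaceLebesgue_eq_smul_map (B : Module.Basis (Fin d) ℝ L) :
    ∃ c : ℝ≥0∞, c ≠ 0 ∧ c ≠ ∞ ∧
      subspaceLebesgue L = c • (volume : Measure (Fin d → ℝ)).map B.equivFunL.symm := by
  have : (subspaceLebesgue L).IsAddHaarMeasure := by unfold subspaceLebesgue; infer_instance
  exact ⟨Measure.addHaarScalarFactor _ _,
    ENNReal.coe_ne_zero.2 (Measure.addHaarScalarFactor_pos_of_isAddHaarMeasure _ _).ne',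
    ENNReal.coe_ne_top, Measure.isAddLeftInvariant_eq_smul _ _⟩

/-- By uniqueness of Haar measure, changing from an orthonormal basis to `B` multiplies Lebesgue
measure by a constant, which occurs in both density and normalizer and cancels. -/
lemma gaussianOn_eq_smul_map (B : Module.Basis (Fin d) ℝ L) (hq : Continuous q)
    (hint : Integrable fun s : Fin d → ℝ =>
      Real.exp (-(1 / 2) * q (B.equivFunL.symm s : E n))) :
    gaussianOn L q = (ENNReal.ofReal
        (∫ s : Fin d → ℝ, Real.exp (-(1 / 2) * q (B.equivFunL.symm s : E n))))⁻¹ •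
      ((volume : Measure (Fin d → ℝ)).withDensity fun s => ENNReal.ofReal
        (Real.exp (-(1 / 2) * q (B.equivFunL.symm s : E n)))).map
          fun s => (B.equivFunL.symm s : E n) := by
  obtain ⟨c, hc0, hctop, hc⟩ := exists_subspaceLebesgue_eq_smul_map B
  have hB : Measurable (B.equivFunL.symm : (Fin d → ℝ) → L) :=
    B.equivFunL.symm.continuous.measurable
  have hdens : Measurable fun x : L => ENNReal.ofReal (Real.exp (-(1 / 2) * q x)) := by
    have : Continuous fun x : L => Real.exp (-(1 / 2) * q x) :=
      Real.continuous_exp.comp ((hq.comp continuous_subtype_val).const_mul _)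
    exact this.measurable.ennreal_ofReal
  have hmeas : Measurable fun s : Fin d → ℝ => (B.equivFunL.symm s : E n) :=
    measurable_subtype_coe.comp hB
  refine Measure.ext_of_lintegral _ fun g hg => ?_
  have hg' : Measurable fun x : L => g x := hg.comp measurable_subtype_coe
  have h := lintegral_withDensity_eq_lintegral_mul volume (hdens.comp hB) (hg'.comp hB)
  simp only [Function.comp_def] at h
  rw [gaussianOn, lintegral_smul_measure, lintegral_smul_measure,
    lintegral_map hg measurable_subtype_coe, lintegral_map hg hmeas,
    lintegral_withDensity_eq_lintegral_mul _ hdens hg',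
    h, hc,
    lintegral_smul_measure, lintegral_smul_measure, lintegral_map hdens hB,
    lintegral_map (hdens.mul hg') hB, ofReal_integral_eq_lintegral_ofReal hint
      (Eventually.of_forall fun _ => (Real.exp_pos _).le)]
  simp only [smul_eq_mul]
  rw [ENNReal.mul_inv (Or.inl hc0) (Or.inl hctop), mul_comm c⁻¹, mul_assoc,
    ENNReal.inv_mul_cancel_left hc0 hctop]
  rfl

lemma isProbabilityMeasure_gaussianOn (B : Module.Basis (Fin d) ℝ L) (hq : Continuous q)
    (hint : Integrable fun s : Fin d → ℝ =>
      Real.exp (-(1 / 2) * q (B.equivFunL.symm s : E n))) :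
    IsProbabilityMeasure (gaussianOn L q) := by
  have hmeas : Measurable fun s : Fin d → ℝ => (B.equivFunL.symm s : E n) :=
    measurable_subtype_coe.comp B.equivFunL.symm.continuous.measurable
  constructor
  rw [gaussianOn_eq_smul_map B hq hint, Measure.smul_apply, Measure.map_apply hmeas .univ,
    Set.preimage_univ, withDensity_apply _ .univ, Measure.restrict_univ,
    ← ofReal_integral_eq_lintegral_ofReal hint
      (Eventually.of_forall fun _ => (Real.exp_pos _).le), smul_eq_mul]
  refine ENNReal.inv_mul_cancel ?_ ENNReal.ofReal_ne_top
  rw [Ne, ENNReal.ofReal_eq_zero, not_le]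
  exact integral_exp_pos hint

lemma integral_gaussianOn (B : Module.Basis (Fin d) ℝ L) (hq : Continuous q)
    (hint : Integrable fun s : Fin d → ℝ =>
      Real.exp (-(1 / 2) * q (B.equivFunL.symm s : E n))) {f : E n → ℝ} (hf : Continuous f) :
    ∫ x, f x ∂(gaussianOn L q) =
      (∫ s : Fin d → ℝ, Real.exp (-(1 / 2) * q (B.equivFunL.symm s : E n)))⁻¹ *
        ∫ s : Fin d → ℝ, Real.exp (-(1 / 2) * q (B.equivFunL.symm s : E n)) *
          f (B.equivFunL.symm s) := by
  have hcont : Continuous fun s : Fin d → ℝ => (B.equivFunL.symm s : E n) :=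
    continuous_subtype_val.comp B.equivFunL.symm.continuous
  have hdens : Measurable fun s : Fin d → ℝ =>
      ENNReal.ofReal (Real.exp (-(1 / 2) * q (B.equivFunL.symm s : E n))) :=
    (Real.continuous_exp.comp ((hq.comp hcont).const_mul _)).measurable.ennreal_ofReal
  rw [gaussianOn_eq_smul_map B hq hint, integral_smul_measure,
    integral_map hcont.measurable.aemeasurable hf.aestronglyMeasurable,
    integral_withDensity_eq_integral_toReal_smul hdens
      (Eventually.of_forall fun _ => ENNReal.ofReal_lt_top), ENNReal.toReal_inv,
    ENNReal.toReal_ofReal (integral_nonneg fun _ => (Real.exp_pos _).le)]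
  simp only [ENNReal.toReal_ofReal (Real.exp_pos _).le, smul_eq_mul]

end Gaussian

/-! ### Centring at the mean and weak convergence. -/

section Convergence

variable {n r d : ℕ} {v : Fin r → Fin n → ℤ} {a : Fin r → ℤ}

lemma integrable_id_law (hcompact : IsCompact (polyhedron v a)) {k : ℕ} (hk : 0 < k)
    [IsProbabilityMeasure (law v (k • a))] : Integrable (fun x => x) (law v (k • a)) := by
  obtain ⟨R, hR⟩ := hcompact.isBounded.exists_norm_le
  have hk' : (0 : ℝ) < k := by exact_mod_cast hk
  refine Integrable.of_bound aestronglyMeasurable_id (k * R) ?_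
  rw [law]
  refine Measure.ae_smul_measure ?_ _
  rw [Measure.ae_sum_iff]
  refine fun x => Measure.ae_smul_measure ?_ _
  rw [ae_dirac_eq]
  have h := hR _ (smul_inv_mem_polyhedron hk x.2)
  rw [norm_smul, norm_inv, Real.norm_natCast, inv_mul_le_iff₀ hk'] at h
  exact h

lemma isProbabilityMeasure_rescaledLaw (k : ℕ) [IsProbabilityMeasure (law v (k • a))] :
    IsProbabilityMeasure (rescaledLaw v a k) :=
  Measure.isProbabilityMeasure_map (by fun_prop)

/-- Recentering at `k m` instead of at the mean. -/
lemma integral_rescaledLaw (hcompact : IsCompact (polyhedron v a)) {k : ℕ} (hk : 0 < k)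
    [IsProbabilityMeasure (law v (k • a))] (m : E n) {f : E n → ℝ} (hf : Continuous f) :
    ∫ x, f x ∂(rescaledLaw v a k) =
      ∫ x, f ((√k)⁻¹ • (x - (k : ℝ) • m) -
        ∫ y, (√k)⁻¹ • (y - (k : ℝ) • m) ∂(law v (k • a))) ∂(law v (k • a)) := by
  rw [rescaledLaw, integral_map (by fun_prop) hf.aestronglyMeasurable, integral_smul,
    integral_sub (integrable_id_law hcompact hk) (integrable_const _), integral_const]
  refine integral_congr_ae (Eventually.of_forall fun x => ?_)
  simp only [probReal_univ, one_smul, ← smul_sub, sub_sub_sub_cancel_right]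

lemma integral_odd_eq_zero {X : Type*} [NormedAddCommGroup X] [NormedSpace ℝ X]
    {f : (Fin d → ℝ) → X} (hf : ∀ s, f (-s) = -f s) : ∫ s, f s = 0 := by
  have h := integral_neg_eq_self f volume
  simp only [hf, integral_neg] at h
  have h2 : (2 : ℝ) • ∫ s, f s = 0 := by
    rw [two_smul]
    nth_rewrite 1 [← h]
    exact neg_add_cancel _
  exact (smul_eq_zero.1 h2).resolve_left two_ne_zero

lemma tendsto_rescaledLaw (hsum : ∑ i, v i = 0) (hcompact : IsCompact (polyhedron v a))
    (htouch : ∀ i, (hyperplane v a i ∩ polyhedron v a).Nonempty) {m : E n}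
    (hm : m ∈ polyhedron v a) (hmin : IsMinOn (logPotential v a) (polyhedron v a) m) :
    ∃ (hY : ∀ k : admissible v a, IsProbabilityMeasure (rescaledLaw v a k))
      (hG : IsProbabilityMeasure (gaussianOn (directionSpace v a) (quadForm v a m))),
      Tendsto (β := ProbabilityMeasure (E n))
        (fun k : admissible v a => ⟨rescaledLaw v a k, hY k⟩)
        (comap (fun k : admissible v a => (k : ℕ)) atTop)
        (𝓝 ⟨gaussianOn (directionSpace v a) (quadForm v a m), hG⟩) := by
  have hpos : ∀ i ∈ nonconstIndices v a, 0 < gap v a i m :=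
    fun i hi => gap_pos_of_isMinOn hm hmin hi
  have hlaw : ∀ k : admissible v a, IsProbabilityMeasure (law v ((k : ℕ) • a)) := fun k =>
    isProbabilityMeasure_law k.2.2 (finite_latticePoints hcompact k.2.1)
  obtain ⟨d, B, b, hB, hspan⟩ := exists_lattice_basis _ (directionSpace_le_span htouch)
  have hBs : ∀ s, (B.equivFunL.symm s : E n) = latticeParam b s := fun s => by
    rw [latticeParam_apply]
    have : B.equivFunL.symm s = ∑ j, s j • B j := B.equivFun_symm_apply s
    rw [this]
    simp [hB]
  have hbL : ∀ s, latticeParam b s ∈ directionSpace v a := fun s => by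
    rw [← hBs]; exact (B.equivFunL.symm s).2
  have hb0 : ∀ u, latticeParam b u = 0 → u = 0 := fun u hu => by
    rw [← hBs] at hu
    exact B.equivFunL.symm.map_eq_zero_iff.1 (Subtype.ext hu)
  have hb : ∀ u, (∀ i ∈ nonconstIndices v a, pairing (v i) (latticeParam b u) = 0) → u = 0 := by
    refine fun u hu => hb0 u ?_
    by_contra h
    obtain ⟨i, hi, hne⟩ := exists_pairing_ne_zero hcompact htouch (hbL u) h
    exact hne (hu i hi)
  have hint := integrable_exp_neg_quadForm (a := a) hpos hb
  have hint' : Integrable fun s : Fin d → ℝ =>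
      Real.exp (-(1 / 2) * quadForm v a m (B.equivFunL.symm s : E n)) := by
    simpa only [hBs] using hint
  refine ⟨fun k => have := hlaw k; isProbabilityMeasure_rescaledLaw _,
    isProbabilityMeasure_gaussianOn B (continuous_quadForm m) hint', ?_⟩
  have hzero : ∀ (k : admissible v a), ∀ x ∈ latticePoints v ((k : ℕ) • a),
      ∀ i ∉ nonconstIndices v a, gap v ((k : ℕ) • a) i (toReal x) = 0 :=
    fun k x hx i hi => gap_nsmul_eq_zero htouch k.2.1 hx hi
  choose x₀ hx₀ using fun k : admissible v a => k.2.2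
  have hx₀L := fun k : admissible v a =>
    smul_sub_mem_directionSpace htouch hm (hzero k (x₀ k) (hx₀ k))
  -- Coordinates of `k m` relative to the coset origin `x₀ k`; they record how the lattice is
  -- shifted against `k m`.
  let τ : admissible v a → Fin d → ℝ := fun k => B.equivFunL ⟨_, hx₀L k⟩
  have hτ : ∀ k : admissible v a,
      ((k : ℕ) : ℝ) • m = toReal (x₀ k) + latticeParam b (τ k) := fun k => by
    rw [← hBs]
    simp [τ]
  have hk0 : ∀ k : admissible v a, 0 < √((k : ℕ) : ℝ) := fun k =>
    Real.sqrt_pos.2 (by exact_mod_cast k.2.1)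
  choose C hC hw using fun k : admissible v a =>
    exists_weight_eq_mul_productWeight hsum htouch hm hmin k.2.1 (hx₀ k)
  have hinj : ∀ k, Function.Injective (latticeMap (x₀ k) b) := fun k z z' h => by
    have h1 := congrArg toReal (add_left_cancel h)
    rw [toReal_sum_smul, toReal_sum_smul, ← latticeParam_apply b fun j => (z j : ℝ),
      ← latticeParam_apply b fun j => (z' j : ℝ), ← sub_eq_zero, ← map_sub] at h1
    have h2 := hb0 _ h1
    ext j
    have h3 := congrFun h2 j
    simp only [Pi.sub_apply, Pi.zero_apply, sub_eq_zero] at h3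
    exact_mod_cast h3
  have hrange : ∀ k : admissible v a,
      latticePoints v ((k : ℕ) • a) ⊆ Set.range (latticeMap (x₀ k) b) := fun k x hx => by
    obtain ⟨c, hc⟩ := hspan (x - x₀ k) (by
      rw [toReal_sub]
      have := (directionSpace v a).sub_mem (hx₀L k)
        (smul_sub_mem_directionSpace htouch hm (hzero k x hx))
      rwa [sub_sub_sub_cancel_left] at this)
    exact ⟨c, by rw [latticeMap, ← hc, add_sub_cancel]⟩
  let T : admissible v a → E n → E n := fun k x => (√((k : ℕ) : ℝ))⁻¹ • (x - ((k : ℕ) : ℝ) • m)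
  have hT : ∀ k s, T k (toReal (latticeMap (x₀ k) b (cellIndex (τ k) √((k : ℕ) : ℝ) s))) =
      latticeParam b (cellOffset (τ k) √((k : ℕ) : ℝ) s) := fun k s => by
    simp only [T]
    rw [toReal_latticeMap_cellIndex (hτ k) (hk0 k), add_sub_cancel_left,
      inv_smul_smul₀ (hk0 k).ne']
  have hformula : ∀ (k : admissible v a) {X : Type} [NormedAddCommGroup X] [NormedSpace ℝ X]
      {G : E n → X}, StronglyMeasurable G → ∫ x, G (T k x) ∂(law v ((k : ℕ) • a)) =
        (∫ s, cellDensity v a m k (latticeMap (x₀ k) b (cellIndex (τ k) √((k : ℕ) : ℝ) s)))⁻¹ •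
          ∫ s, cellDensity v a m k (latticeMap (x₀ k) b (cellIndex (τ k) √((k : ℕ) : ℝ) s)) •
            G (latticeParam b (cellOffset (τ k) √((k : ℕ) : ℝ) s)) := by
    intro k X _ _ G hG
    have := hlaw k
    rw [integral_map_law_eq hm (hC k).le (hw k) (hinj k) (hrange k) (τ k) (hk0 k) (T := T k)
      (by fun_prop) hG]
    simp only [hT]
  set F := comap (fun k : admissible v a => (k : ℕ)) atTop with hF
  have hk : Tendsto (fun k : admissible v a => (k : ℕ)) F atTop := tendsto_comap
  have hden := tendsto_integral_cellDensity hsum htouch hm hpos hbL hb hk hτ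
    (G := fun _ _ => (1 : ℝ)) (G₀ := fun _ => 1) (M := 1) (fun _ => stronglyMeasurable_const)
    (fun _ y => by simp) (fun _ _ _ => tendsto_const_nhds)
  simp only [smul_eq_mul, mul_one] at hden
  have hZ : 0 < ∫ s, Real.exp (-(1 / 2) * quadForm v a m (latticeParam b s)) :=
    integral_exp_pos hint
  have hden' := hden.inv₀ hZ.ne'
  let e : admissible v a → E n := fun k => ∫ y, T k y ∂(law v ((k : ℕ) • a))
  -- The rescaled distance of the mean from `k m`: its limit is the integral of an odd function.
  have he : Tendsto e F (𝓝 0) := by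
    have h1 := tendsto_integral_cellDensity hsum htouch hm hpos hbL hb hk hτ
      (G := fun _ y => y) (G₀ := fun y => y) (M := 1) (fun _ => stronglyMeasurable_id)
      (fun _ y => by simp) (fun _ _ h => h)
    have h2 : ∫ s, Real.exp (-(1 / 2) * quadForm v a m (latticeParam b s)) • latticeParam b s
        = 0 := by
      refine integral_odd_eq_zero fun s => ?_
      have : ∀ y, quadForm v a m (-y) = quadForm v a m y := fun y => by
        simp only [quadForm, ← pairingL_apply, map_neg, neg_sq]
      rw [map_neg, this, smul_neg]
    have h3 := hden'.smul h1
    rw [h2, smul_zero] at h3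
    exact h3.congr fun k => (hformula k (G := fun y => y) stronglyMeasurable_id).symm
  refine ProbabilityMeasure.tendsto_iff_forall_integral_tendsto.2 fun f => ?_
  -- Centring at the mean makes the test function depend on `k` through the shift `e k`. Since `e k
  -- → 0`, the shifted functions still converge along convergent arguments.
  have hnum := tendsto_integral_cellDensity hsum htouch hm hpos hbL hb hk hτ
    (G := fun k y => f (y - e k)) (G₀ := f) (M := ‖f‖)
    (fun k => (f.continuous.comp (continuous_sub_right (e k))).stronglyMeasurable)
    (fun k y => (f.norm_coe_le_norm _).trans (le_mul_of_one_le_right (norm_nonneg f)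
      (le_add_of_nonneg_right (norm_nonneg y))))
    (fun y y₀ hy => by
      have := (f.continuous.tendsto _).comp (hy.sub he)
      rwa [sub_zero] at this)
  have hfin := hden'.smul hnum
  have hlim : ∫ x, f x ∂(gaussianOn (directionSpace v a) (quadForm v a m)) =
      (∫ s, Real.exp (-(1 / 2) * quadForm v a m (latticeParam b s)))⁻¹ •
        ∫ s, Real.exp (-(1 / 2) * quadForm v a m (latticeParam b s)) • f (latticeParam b s) := by
    rw [integral_gaussianOn B (continuous_quadForm m) hint' f.continuous]
    simp only [hBs, smul_eq_mul]
  rw [← hlim] at hfin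
  refine hfin.congr fun k => ?_
  have := hlaw k
  exact (hformula k (G := fun y => f (y - e k))
    (f.continuous.comp (continuous_sub_right (e k))).stronglyMeasurable).symm.trans
      (integral_rescaledLaw hcompact k.2.1 m f.continuous).symm

end Convergence

end PolyMult

end

theorem theorem1p1 (n r : ℕ) (v : Fin r → Fin n → ℤ) (a : Fin r → ℤ)
    (hsum : ∑ i, v i = 0)
    (hcompact : IsCompact (PolyMult.polyhedron v a))
    (htouch : ∀ i, (PolyMult.hyperplane v a i ∩ PolyMult.polyhedron v a).Nonempty) :
    (PolyMult.admissible v a).Infinite ∧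
    ∃ m ∈ intrinsicInterior ℝ (PolyMult.polyhedron v a),
      IsMinOn (PolyMult.potential v a) (PolyMult.polyhedron v a) m ∧
      (∀ m' ∈ PolyMult.polyhedron v a,
        IsMinOn (PolyMult.potential v a) (PolyMult.polyhedron v a) m' → m' = m) ∧
      (∀ x ∈ PolyMult.directionSpace v a, x ≠ 0 → 0 < PolyMult.quadForm v a m x) ∧
      ∃ (hY : ∀ k : PolyMult.admissible v a,
            IsProbabilityMeasure (PolyMult.rescaledLaw v a k))
        (hG : IsProbabilityMeasure
            (PolyMult.gaussianOn (PolyMult.directionSpace v a) (PolyMult.quadForm v a m))),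
        Tendsto (β := ProbabilityMeasure (PolyMult.E n))
          (fun k : PolyMult.admissible v a =>
            ⟨PolyMult.rescaledLaw v a k, hY k⟩)
          (comap (fun k : PolyMult.admissible v a => (k : ℕ)) atTop)
          (𝓝 ⟨PolyMult.gaussianOn (PolyMult.directionSpace v a) (PolyMult.quadForm v a m), hG⟩) := by
  have hne := PolyMult.polyhedron_nonempty htouch
  obtain ⟨m, hm, hmin⟩ := PolyMult.exists_isMinOn_logPotential hcompact hne
  have hpos : ∀ i ∈ PolyMult.nonconstIndices v a, 0 < PolyMult.gap v a i m :=
    fun i hi => PolyMult.gap_pos_of_isMinOn hm hmin hi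
  exact ⟨PolyMult.infinite_admissible htouch, m,
    PolyMult.mem_intrinsicInterior_of_gap_pos htouch hm hpos,
    (PolyMult.isMinOn_potential_iff hm).2 hmin,
    fun m' hm' hmin' => PolyMult.isMinOn_logPotential_unique hcompact hm hm' hmin
      ((PolyMult.isMinOn_potential_iff hm').1 hmin'),
    fun x hx hx0 => PolyMult.quadForm_pos hcompact htouch hpos hx hx0,
    PolyMult.tendsto_rescaledLaw hsum hcompact htouch hm hmin⟩
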